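/- Let $V$ be a two-dimensional vector space over $\mathbb{Q}$ with a positive definite quadratic form $Q$ and bilinear form $B$, $2B(x,y)=Q(x+y)-Q(x)-Q(y)$, and let $L=\mathbb{Z}e_1+\mathbb{Z}e_2$ be a $\mathbb{Z}$-lattice on $V$ (so $e_1,e_2$ is a $\mathbb{Q}$-basis of $V$) with $Q(L)\subseteq\mathbb{Z}$. Let $d_L=\det\big(B(e_i,e_j)\big)$ and suppose that $-4d_L$ is the discriminant of an imaginary quadratic field $F$ (so $F\cong\mathbb{Q}(\sqrt{-4d_L})$). Two sublattices of finite index in $L$ are called properly isometric if some $\mathbb{Q}$-linear automorphism of $V$ of determinant $1$ preserving $Q$ maps one onto the other. Let $a_m^+(L)$ be the number of proper isometry classes of sublattices $K\subseteq L$ with $|L:K|=m$, and put $\zeta_L^+(s)=\sum_{m\ge1}a_m^+(L)\,m^{-s}$. Let $\mathcal{O}_F$, $\mathcal{O}_F^\times$, $\mathrm{Cl}_F$ and $\zeta_F$ be the ring of integers, the unit group, the ideal class group and the Dedekind zeta function of $F$, let $\zeta$ be the Riemann zeta function, and for a nonzero ideal $J\le\mathcal{O}_F$ let $N(J)=|\mathcal{O}_F:J|$.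 Then for every complex $s$ with $\operatorname{Re}(s)>2$ the series below and the Dirichlet series of $\zeta_F(s)$ converge absolutely, the product below converges unconditionally, $\zeta_F(s)\neq0$, and \[ \zeta_L^+(s)=\frac{2}{|\mathcal{O}_F^\times|}\,\frac{\zeta(s)\zeta(s-1)}{\zeta_F(s)}\left(\sum_{n=1}^\infty\frac{\#\{[J]\in\mathrm{Cl}_F: J\le\mathcal{O}_F,\ N(J)=n\}}{n^{s}}\right)+\frac{|\mathcal{O}_F^\times|-2}{|\mathcal{O}_F^\times|}\left(\prod_{p\ \mathrm{split}}(1-p^{-s})\right)\zeta_F(s), \] where the product runs over all rational primes $p$ that split in $F$ (those over which there are exactly two prime ideals of $\mathcal{O}_F$). -/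

import Mathlib

namespace BinaryLattice

open scoped nonZeroDivisors

section Lattice

variable {V : Type*} [AddCommGroup V] [Module ℚ V]

/-- The Gram matrix `(B(e_i, e_j))` of a family `e`, where `B` is the symmetric bilinear form
with `2 B(x, y) = Q(x + y) - Q(x) - Q(y)`. -/
def gramMatrix {ι : Type*} (Q : QuadraticForm ℚ V) (e : ι → V) : Matrix ι ι ℚ :=
  Matrix.of fun i j => (Q (e i + e j) - Q (e i) - Q (e j)) / 2

/-- The special orthogonal group `O⁺(V)` of the quadratic space `(V, Q)`: linear automorphisms of
`V` that preserve `Q` (equivalently, its bilinear form) and have determinant `1`. -/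
def properOrthogonalGroup (Q : QuadraticForm ℚ V) : Subgroup (V ≃ₗ[ℚ] V) where
  carrier := {σ | (∀ x, Q (σ x) = Q x) ∧ LinearEquiv.det σ = 1}
  mul_mem' := by
    rintro σ τ ⟨hσ, hσd⟩ ⟨hτ, hτd⟩
    exact ⟨fun x => by rw [LinearEquiv.mul_apply, hσ, hτ], by rw [map_mul, hσd, hτd, mul_one]⟩
  one_mem' := ⟨fun _ => rfl, map_one _⟩
  inv_mem' := by
    rintro σ ⟨hσ, hσd⟩
    exact ⟨fun x => by rw [← hσ, ← LinearEquiv.mul_apply, mul_inv_cancel, LinearEquiv.coe_one, id],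
      by rw [map_inv, hσd, inv_one]⟩

/-- The set of sublattices `K ⊆ L` with `|L : K| = m` (meaningful for `m ≥ 1`). -/
def sublatticesOfIndex (L : Submodule ℤ V) (m : ℕ) : Set (Submodule ℤ V) :=
  {K | K ≤ L ∧ K.toAddSubgroup.relIndex L.toAddSubgroup = m}

/-- Two lattices on `V` are properly isometric if some `σ ∈ O⁺(V)` maps the first one onto the
second one. -/
def ProperlyIsometric (Q : QuadraticForm ℚ V) (K₁ K₂ : Submodule ℤ V) : Prop :=
  ∃ σ ∈ properOrthogonalGroup Q, (σ '' (K₁ : Set V)) = K₂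

/-- Proper isometry, as an equivalence relation on the sublattices of `L` of index `m`. -/
def properIsometrySetoid (Q : QuadraticForm ℚ V) (L : Submodule ℤ V) (m : ℕ) :
    Setoid (sublatticesOfIndex L m) where
  r K₁ K₂ := ProperlyIsometric Q K₁ K₂
  iseqv :=
    { refl := fun K => ⟨1, one_mem _, by simp⟩
      symm := by
        rintro K₁ K₂ ⟨σ, hσ, h⟩
        refine ⟨σ⁻¹, inv_mem hσ, ?_⟩
        rw [← h, Set.image_image]
        convert Set.image_id _ using 2
        ext x
        exact σ.symm_apply_apply x
      trans := by
        rintro K₁ K₂ K₃ ⟨σ, hσ, h⟩ ⟨τ, hτ, h'⟩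
        refine ⟨τ * σ, mul_mem hτ hσ, ?_⟩
        rw [← h', ← h, Set.image_image]
        rfl }

/-- `a_m⁺(L)`: the number of proper isometry classes of sublattices of `L` of index `m`. -/
noncomputable def properClassCount (Q : QuadraticForm ℚ V) (L : Submodule ℤ V) (m : ℕ) : ℕ :=
  Nat.card (Quotient (properIsometrySetoid Q L m))

end Lattice

section Field

variable (F : Type*) [Field F] [NumberField F]

/-- The number of ideal classes of `F` that contain an integral ideal of norm `n`. -/
noncomputable def classCountOfNorm (n : ℕ) : ℕ :=
  Set.ncard {c : ClassGroup (NumberField.RingOfIntegers F) |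
    ∃ J : (Ideal (NumberField.RingOfIntegers F))⁰,
      Ideal.absNorm (J : Ideal (NumberField.RingOfIntegers F)) = n ∧ ClassGroup.mk0 J = c}

/-- The rational primes that are split in the quadratic field `F`, that is, over which there are
exactly two prime ideals. -/
def splitPrimes : Set ℕ :=
  {p | p.Prime ∧
    ((Ideal.span {(p : ℤ)}).primesOver (NumberField.RingOfIntegers F)).ncard = 2}

end Field

end BinaryLattice

/-! The binary form becomes a norm form. If `Q` takes the value `A x² + B x y + C y²` at `x e₀ + y
e₁`, then `B² - 4AC` is the discriminant of `F`, so `𝓞 F = ℤ + ℤω` with `ω² = Bω - AC`. Sending `e₀`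
to `A` and `e₁` to `ω` identifies `V` with `F`, turns `A·Q` into the norm, and carries `L` onto an
ideal `I` (`exists_quadratic_identification`). Proper isometries are then multiplications by
elements of norm one (`exists_eq_mul_of_norm_eq`). Scaling between sublattices of equal index forces
norm one, so `a_m⁺(L)` counts index-`m` subgroups of `I` up to scaling by `Fˣ`
(`properClassCount_eq`).

A subgroup `K` of finite index in an ideal `J` generates an ideal `J * I'`, and its index is `N(I')`
times its index `k` in that ideal. Let `b(k)` be the number of index-`k` subgroups that generate a
given nonzero ideal. Since every rank-two lattice has `σ 1 m` sublattices of index `m`, induction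
shows that `b(k)` does not depend on the ideal, and `ζ(s)ζ(s-1) = ζ_F(s) · ∑ b(k) k^{-s}`.

Up to scaling, `I'` can be a fixed representative of its class among ideals of norm `n`, and only
units remain to act. Burnside's lemma counts the orbits: `±1` fix every subgroup, while any other
unit generates `𝓞 F` as a ring and so fixes only ideals, which means `k = 1`. With `w` units and
`h(n)` classes containing an ideal of norm `n`, this gives `w a_m⁺ = ∑_{nk=m} h(n) (2 b(k) + (w-2)
δ(k))`.

The first summand yields the first term of the formula. The second matters only if `w > 2`; then the
discriminant is at least `-4` and the class number is one, so `h` is the indicator of ideal norms.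
Comparison at prime powers shows that `ζ_F` is the series of `h` times the Euler product over split
primes. -/

namespace BinaryLattice

open ArithmeticFunction ArithmeticFunction.sigma

/-! ### Counting sublattices of a rank-two lattice by Hermite normal form. -/

section SublatticeCount

/-- The subgroup of `ℤ²` spanned by `(d, 0)` and `(c, a)`. -/
def hermiteSubgroup (a d c : ℤ) : AddSubgroup (Fin 2 → ℤ) :=
  (LinearMap.range (Matrix.toLin' !![d, c; 0, a])).toAddSubgroup

theorem mem_hermiteSubgroup {a d c : ℤ} {x : Fin 2 → ℤ} :
    x ∈ hermiteSubgroup a d c ↔ ∃ u v : ℤ, x 0 = d * u + c * v ∧ x 1 = a * v := by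
  constructor
  · rintro ⟨y, rfl⟩
    exact ⟨y 0, y 1, by simp [Matrix.vecHead, Matrix.vecTail]⟩
  · rintro ⟨u, v, h0, h1⟩
    refine ⟨![u, v], ?_⟩
    ext i
    fin_cases i <;> simp [h0, h1, mul_comm]

theorem index_hermiteSubgroup {a d : ℤ} (ha : a ≠ 0) (hd : d ≠ 0) (c : ℤ) :
    (hermiteSubgroup a d c).index = d.natAbs * a.natAbs := by
  set f := Matrix.toLin' !![d, c; 0, a] with hf
  have hdet : LinearMap.det f = d * a := by simp [hf, Matrix.det_fin_two]
  have hinj : Function.Injective f := by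
    rw [← LinearMap.ker_eq_bot]
    by_contra h
    have := LinearMap.det_eq_zero_iff_ker_ne_bot.mpr h
    rw [hdet] at this
    simp_all
  have := Submodule.natAbs_det_equiv (LinearMap.range f) (LinearEquiv.ofInjective f hinj)
  have hcomp : (LinearMap.range f).subtype ∘ₗ
      AddMonoidHom.toIntLinearMap (LinearEquiv.ofInjective f hinj : _ →+ _) = f := by
    ext; simp
  rw [hcomp, hdet, Int.natAbs_mul] at this
  exact this.symm

theorem exists_mem_iff_natCast_dvd (H : AddSubgroup ℤ) : ∃ n : ℕ, ∀ x, x ∈ H ↔ (n : ℤ) ∣ x := by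
  obtain ⟨a, rfl⟩ := Int.subgroup_cyclic H
  refine ⟨a.natAbs, fun x => ?_⟩
  rw [AddSubgroup.mem_closure_singleton, Int.natAbs_dvd]
  exact ⟨fun ⟨k, hk⟩ => ⟨k, by rw [← hk, smul_eq_mul, mul_comm]⟩,
    fun ⟨k, hk⟩ => ⟨k, by rw [hk, smul_eq_mul, mul_comm]⟩⟩

/-- The projection of `K` to the second coordinate is `aℤ`, its intersection with the first axis is
`dℤ`, and `c` is the first coordinate of a lift of `a`, reduced mod `d`. Finite index keeps `a` and
`d` nonzero. -/
theorem exists_eq_hermiteSubgroup (K : AddSubgroup (Fin 2 → ℤ)) (hK : K.index ≠ 0) :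
    ∃ a d c : ℕ, a ≠ 0 ∧ c < d ∧ K = hermiteSubgroup a d c := by
  have hmem : ∀ x : Fin 2 → ℤ, (K.index : ℤ) • x ∈ K := fun x => by
    simpa using K.nsmul_index_mem x
  obtain ⟨a, ha⟩ := exists_mem_iff_natCast_dvd
    (K.map (Pi.evalAddMonoidHom (fun _ : Fin 2 => ℤ) 1))
  obtain ⟨d, hd⟩ := exists_mem_iff_natCast_dvd
    (K.comap (AddMonoidHom.single (fun _ : Fin 2 => ℤ) 0))
  have ha0 : a ≠ 0 := by
    rintro rfl
    have := (ha K.index).mp ⟨_, hmem ![0, 1], by simp⟩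
    simp_all
  have hd' : ∀ x : ℤ, ![x, 0] ∈ K ↔ (d : ℤ) ∣ x := fun x => by
    rw [← hd x, AddSubgroup.mem_comap]
    congr! 1
    ext i; fin_cases i <;> simp
  have hd0 : d ≠ 0 := by
    rintro rfl
    have := (hd' K.index).mp (by simpa using hmem ![1, 0])
    simp_all
  obtain ⟨y, hy, hya⟩ := (ha a).mpr dvd_rfl
  replace hya : y 1 = a := hya
  refine ⟨a, d, (y 0 % d).toNat, ha0, ?_, ?_⟩
  · zify
    rw [Int.toNat_of_nonneg (Int.emod_nonneg _ (by exact_mod_cast hd0))]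
    exact Int.emod_lt_of_pos _ (by omega)
  · ext x
    rw [mem_hermiteSubgroup, Int.toNat_of_nonneg (Int.emod_nonneg _ (by exact_mod_cast hd0))]
    have hsub : ∀ v : ℤ, x 1 = a * v → (x ∈ K ↔ (d : ℤ) ∣ x 0 - v * y 0) := fun v hv => by
      rw [← hd', show ![x 0 - v * y 0, 0] = x - v • y by
        ext i; fin_cases i <;> simp [hv, hya, mul_comm]]
      rw [sub_eq_add_neg, add_mem_cancel_right (neg_mem (K.zsmul_mem hy v))]
    constructor
    · intro hx
      obtain ⟨v, hv⟩ := (ha (x 1)).mp ⟨x, hx, rfl⟩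
      obtain ⟨u, hu⟩ := (hsub v hv).mp hx
      refine ⟨u + v * (y 0 / d), v, ?_, hv⟩
      linear_combination hu - v * Int.emod_add_mul_ediv (y 0) d
    · rintro ⟨u, v, hu, hv⟩
      refine (hsub v hv).mpr ⟨u - v * (y 0 / d), ?_⟩
      linear_combination hu + v * Int.emod_add_mul_ediv (y 0) d

theorem hermiteSubgroup_injective {a d c a' d' c' : ℕ} (hc : c < d) (hc' : c' < d')
    (ha : a ≠ 0) (ha' : a' ≠ 0)
    (h : hermiteSubgroup a d c = hermiteSubgroup a' d' c') : a = a' ∧ d = d' ∧ c = c' := by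
  have key : ∀ {a d c a' d' c' : ℕ}, a' ≠ 0 →
      hermiteSubgroup a d c ≤ hermiteSubgroup a' d' c' → a' ∣ a ∧ d' ∣ d := by
    intro a d c a' d' c' ha' h
    obtain ⟨u, v, -, h1⟩ := mem_hermiteSubgroup.mp (h ((mem_hermiteSubgroup
      (x := ![(c : ℤ), a])).mpr ⟨0, 1, by simp, by simp⟩))
    obtain ⟨u', v', h2, h3⟩ := mem_hermiteSubgroup.mp (h ((mem_hermiteSubgroup
      (x := ![(d : ℤ), 0])).mpr ⟨1, 0, by simp, by simp⟩))
    simp only [Matrix.cons_val_zero, Matrix.cons_val_one] at h1 h2 h3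
    have : v' = 0 := by simpa [ha'] using h3
    subst this
    exact ⟨Int.natCast_dvd_natCast.mp ⟨v, h1⟩, Int.natCast_dvd_natCast.mp ⟨u', by simpa using h2⟩⟩
  obtain ⟨h1, h2⟩ := key ha' h.le
  obtain ⟨h3, h4⟩ := key ha h.ge
  obtain rfl := Nat.dvd_antisymm h1 h3
  obtain rfl := Nat.dvd_antisymm h2 h4
  refine ⟨rfl, rfl, ?_⟩
  obtain ⟨u, v, h5, h6⟩ := mem_hermiteSubgroup.mp (h.le ((mem_hermiteSubgroup
      (x := ![(c : ℤ), a'])).mpr ⟨0, 1, by simp, by simp⟩))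
  simp only [Matrix.cons_val_zero, Matrix.cons_val_one] at h5 h6
  have : v = 1 := by
    have : (a' : ℤ) ≠ 0 := by exact_mod_cast ha'
    exact mul_left_cancel₀ this (by rw [← h6, mul_one])
  subst this
  have : c ≡ c' [MOD d'] := by
    rw [← Int.natCast_modEq_iff]
    exact (Int.modEq_iff_dvd.mpr ⟨-u, by linarith⟩)
  exact Nat.ModEq.eq_of_lt_of_lt this hc hc'

/-- For each factorization `a d = m` the normal form leaves `d` choices of `c`, and these sum to `σ
1 m`. -/
theorem card_addSubgroup_index_eq {m : ℕ} (hm : m ≠ 0) :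
    Nat.card {K : AddSubgroup (Fin 2 → ℤ) // K.index = m} = σ 1 m := by
  let f : (Σ p : m.divisorsAntidiagonal, Fin p.1.2) →
      {K : AddSubgroup (Fin 2 → ℤ) // K.index = m} := fun x =>
    ⟨hermiteSubgroup x.1.1.1 x.1.1.2 x.2, by
      obtain ⟨⟨⟨a, d⟩, h⟩, c⟩ := x
      obtain ⟨h, -⟩ := Nat.mem_divisorsAntidiagonal.mp h
      simp only at h
      rw [index_hermiteSubgroup]
      · simp [← h, mul_comm]
      · rintro h0; simp_all
      · rintro h0; simp_all⟩
  have hf : Function.Bijective f := by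
    constructor
    · rintro ⟨⟨⟨a, d⟩, h⟩, c⟩ ⟨⟨⟨a', d'⟩, h'⟩, c'⟩ hh
      have h1 : a ≠ 0 := (Nat.pos_of_mem_divisors (Nat.fst_mem_divisors_of_mem_antidiagonal h)).ne'
      have h2 : a' ≠ 0 :=
        (Nat.pos_of_mem_divisors (Nat.fst_mem_divisors_of_mem_antidiagonal h')).ne'
      obtain ⟨rfl, rfl, h3⟩ := hermiteSubgroup_injective c.2 c'.2 h1 h2 (congrArg Subtype.val hh)
      obtain rfl := Fin.ext h3
      rfl
    · rintro ⟨K, hK⟩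
      obtain ⟨a, d, c, ha, hc, rfl⟩ := exists_eq_hermiteSubgroup K (by rwa [hK])
      rw [index_hermiteSubgroup (by exact_mod_cast ha) (by omega)] at hK
      exact ⟨⟨⟨(a, d), Nat.mem_divisorsAntidiagonal.mpr ⟨by simpa [mul_comm] using hK, hm⟩⟩,
        ⟨c, hc⟩⟩, rfl⟩
  rw [← Nat.card_congr (Equiv.ofBijective f hf), Nat.card_sigma]
  simp only [Nat.card_eq_fintype_card, Fintype.card_fin]
  rw [Finset.sum_coe_sort m.divisorsAntidiagonal (fun p => p.2), sigma_one_apply,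
    Nat.sum_divisorsAntidiagonal' (fun _ d => d)]

/-- The number of sublattices of index `m` of a lattice of rank two in any abelian group. -/
theorem card_addSubgroup_relIndex_eq {A : Type*} [AddCommGroup A] (H : AddSubgroup A)
    (b : Module.Basis (Fin 2) ℤ H) {m : ℕ} (hm : m ≠ 0) :
    Nat.card {K : AddSubgroup A // K ≤ H ∧ K.relIndex H = m} = σ 1 m := by
  rw [← card_addSubgroup_index_eq hm]
  let e : H ≃+ (Fin 2 → ℤ) := b.equivFun.toAddEquiv
  refine Nat.card_congr ⟨fun K => ⟨(K.1.addSubgroupOf H).map e.toAddMonoidHom, ?_⟩,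
    fun K => ⟨(K.1.comap e.toAddMonoidHom).map H.subtype, ?_, ?_⟩, ?_, ?_⟩
  · exact (AddSubgroup.index_map_equiv _ e).trans K.2.2
  · exact AddSubgroup.map_subtype_le _
  · rw [AddSubgroup.relIndex, AddSubgroup.addSubgroupOf,
      AddSubgroup.comap_map_eq_self_of_injective H.subtype_injective,
      AddSubgroup.index_comap_of_surjective _ e.surjective, K.2]
  · intro K
    ext1
    simp only
    rw [AddSubgroup.comap_map_eq_self_of_injective e.injective,
      AddSubgroup.addSubgroupOf, AddSubgroup.map_comap_eq, AddSubgroup.range_subtype]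
    exact inf_eq_right.mpr K.2.1
  · intro K
    ext1
    simp only
    rw [AddSubgroup.addSubgroupOf,
      AddSubgroup.comap_map_eq_self_of_injective H.subtype_injective,
      AddSubgroup.map_comap_eq_self_of_surjective e.surjective]

end SublatticeCount

end BinaryLattice

namespace BinaryLattice

open ArithmeticFunction ArithmeticFunction.sigma NumberField
open scoped nonZeroDivisors Pointwise

/-! ### Subgroups of an ideal, sorted by the ideal they generate. -/

section Sublattices

variable {F : Type*} [Field F]

theorem coe_smul_addSubgroup (u : (𝓞 F)ˣ) (K : AddSubgroup (𝓞 F)) : (u : 𝓞 F) • K = u • K := rfl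

theorem span_smul_addSubgroup (x : 𝓞 F) (K : AddSubgroup (𝓞 F)) :
    Ideal.span ((x • K : AddSubgroup (𝓞 F)) : Set (𝓞 F)) = Ideal.span {x} * Ideal.span K := by
  rw [Ideal.span_mul_span', Set.singleton_mul, AddSubgroup.coe_pointwise_smul]
  rfl

theorem smul_ideal_toAddSubgroup (x : 𝓞 F) (J : Ideal (𝓞 F)) :
    x • J.toAddSubgroup = (Ideal.span {x} * J).toAddSubgroup := by
  ext y
  rw [AddSubgroup.mem_smul_pointwise_iff_exists, Submodule.mem_toAddSubgroup,
    Ideal.mem_span_singleton_mul]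
  rfl

theorem smul_addSubgroup_injective {x : 𝓞 F} (hx : x ≠ 0) :
    Function.Injective (fun K : AddSubgroup (𝓞 F) => x • K) :=
  AddSubgroup.map_injective (f := DistribSMul.toAddMonoidHom (𝓞 F) x) (mul_right_injective₀ hx)

theorem relIndex_smul_smul {x : 𝓞 F} (hx : x ≠ 0) (K H : AddSubgroup (𝓞 F)) :
    (x • K).relIndex (x • H) = K.relIndex H :=
  AddSubgroup.relIndex_map_map_of_injective (f := DistribSMul.toAddMonoidHom (𝓞 F) x) K H
    (mul_right_injective₀ hx)

/-- The subgroups of index `m` in the ideal `J`. -/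
def sublatticesOfIdeal (J : Ideal (𝓞 F)) (m : ℕ) : Set (AddSubgroup (𝓞 F)) :=
  {K | K ≤ J.toAddSubgroup ∧ K.relIndex J.toAddSubgroup = m}

/-- The subgroups of index `k` in the ideal `J` that generate `J`, with the action of the unit
group. -/
def generatingSublattices (J : Ideal (𝓞 F)) (k : ℕ) :
    SubMulAction (𝓞 F)ˣ (AddSubgroup (𝓞 F)) where
  carrier := {K | Ideal.span (K : Set (𝓞 F)) = J ∧ K.relIndex J.toAddSubgroup = k}
  smul_mem' := by
    rintro u K ⟨rfl, hk⟩
    have h1 : Ideal.span {(u : 𝓞 F)} = 1 := by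
      rw [Ideal.one_eq_top, Ideal.span_singleton_eq_top]
      exact u.isUnit
    refine ⟨by rw [← coe_smul_addSubgroup, span_smul_addSubgroup, h1, one_mul], ?_⟩
    rw [← hk, ← relIndex_smul_smul u.ne_zero K, smul_ideal_toAddSubgroup, h1, one_mul]
    rfl

theorem le_of_mem_generatingSublattices {J : Ideal (𝓞 F)} {k : ℕ} {K : AddSubgroup (𝓞 F)}
    (h : K ∈ generatingSublattices J k) : K ≤ J.toAddSubgroup := by
  obtain ⟨rfl, -⟩ := h
  exact Ideal.subset_span

variable [NumberField F]

theorem index_smul {x : 𝓞 F} (hx : x ≠ 0) (K : AddSubgroup (𝓞 F)) :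
    (x • K).index = K.index * Ideal.absNorm (Ideal.span {x}) := by
  have hle : x • K ≤ x • (⊤ : AddSubgroup (𝓞 F)) := AddSubgroup.map_mono le_top
  rw [← AddSubgroup.relIndex_mul_index hle, relIndex_smul_smul hx, AddSubgroup.relIndex_top_right,
    Ideal.absNorm_eq_index]
  congr 2
  have := smul_ideal_toAddSubgroup x (⊤ : Ideal (𝓞 F))
  rwa [Ideal.mul_top] at this

theorem mem_sublatticesOfIdeal_iff_index {J : Ideal (𝓞 F)} (hJ : J ≠ ⊥) {m : ℕ}
    {K : AddSubgroup (𝓞 F)} :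
    K ∈ sublatticesOfIdeal J m ↔ K ≤ J.toAddSubgroup ∧ K.index = m * Ideal.absNorm J := by
  refine and_congr_right fun h => ?_
  rw [← AddSubgroup.relIndex_mul_index h, Ideal.absNorm_eq_index]
  refine (Nat.mul_left_inj ?_).symm
  rw [← Ideal.absNorm_eq_index]
  exact Ideal.absNorm_eq_zero_iff.not.mpr hJ

theorem mem_sublatticesOfIdeal_of_mem_generatingSublattices {J I : Ideal (𝓞 F)} (hJ : J ≠ ⊥)
    (hI : I ≠ ⊥) {k : ℕ} {K : AddSubgroup (𝓞 F)} (h : K ∈ generatingSublattices (J * I) k) :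
    K ∈ sublatticesOfIdeal J (Ideal.absNorm I * k) := by
  have h1 := le_of_mem_generatingSublattices h
  rw [mem_sublatticesOfIdeal_iff_index hJ]
  refine ⟨h1.trans (show J * I ≤ J from Ideal.mul_le_left), ?_⟩
  rw [((mem_sublatticesOfIdeal_iff_index (mul_ne_zero hJ hI)).mp ⟨h1, h.2⟩).2, map_mul]
  ring

/-- In a Dedekind domain containment is divisibility, so the ideal generated by `K` inside `J` has
the form `J * I`. -/
theorem exists_mem_generatingSublattices {J : Ideal (𝓞 F)} (hJ : J ≠ ⊥) {m : ℕ} (hm : m ≠ 0)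
    {K : AddSubgroup (𝓞 F)} (h : K ∈ sublatticesOfIdeal J m) :
    ∃ I : Ideal (𝓞 F), ∃ k : ℕ, I ≠ ⊥ ∧ Ideal.absNorm I * k = m ∧
      K ∈ generatingSublattices (J * I) k := by
  have hKJ : Ideal.span (K : Set (𝓞 F)) ≤ J := Ideal.span_le.mpr h.1
  obtain ⟨I, hI⟩ := Ideal.dvd_iff_le.mpr hKJ
  have hmem : K ∈ generatingSublattices (J * I) (K.relIndex (J * I).toAddSubgroup) := ⟨hI, rfl⟩
  have hidx := ((mem_sublatticesOfIdeal_iff_index hJ).mp h).2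
  -- If `I = ⊥` then `K = ⊥`, whose infinite index is recorded as `0`, whereas the index of `K` is
  -- `m * N(J) ≠ 0`.
  have hI0 : I ≠ ⊥ := by
    rintro rfl
    have h1 : K = ⊥ := by
      rw [eq_bot_iff]
      have := le_of_mem_generatingSublattices hmem
      rwa [Ideal.mul_bot] at this
    rw [h1, AddSubgroup.index_bot, Nat.card_eq_zero_of_infinite] at hidx
    exact mul_ne_zero hm (Ideal.absNorm_eq_zero_iff.not.mpr hJ) hidx.symm
  refine ⟨I, _, hI0, ?_, hmem⟩
  have := (mem_sublatticesOfIdeal_of_mem_generatingSublattices hJ hI0 hmem).2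
  rw [← this, h.2]

theorem finrank_int_ringOfIntegers_eq_two [Algebra.IsQuadraticExtension ℚ F] :
    Module.finrank ℤ (𝓞 F) = 2 := by
  rw [RingOfIntegers.rank, Algebra.IsQuadraticExtension.finrank_eq_two]

theorem card_sublatticesOfIdeal [Algebra.IsQuadraticExtension ℚ F] {J : Ideal (𝓞 F)} (hJ : J ≠ ⊥)
    {m : ℕ} (hm : m ≠ 0) : Nat.card (sublatticesOfIdeal J m) = σ 1 m := by
  let b := (Module.finBasisOfFinrankEq ℤ (𝓞 F) finrank_int_ringOfIntegers_eq_two)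
  exact card_addSubgroup_relIndex_eq J.toAddSubgroup (J.selfBasis b hJ) hm

/-- `Nat.card` of an infinite type is `0`, so a nonzero count already gives finiteness. -/
theorem finite_sublatticesOfIdeal [Algebra.IsQuadraticExtension ℚ F] {J : Ideal (𝓞 F)}
    (hJ : J ≠ ⊥) {m : ℕ} (hm : m ≠ 0) : Finite (sublatticesOfIdeal J m) :=
  Nat.finite_of_card_ne_zero (by rw [card_sublatticesOfIdeal hJ hm, Ne, sigma_eq_zero]; exact hm)

theorem finite_generatingSublattices [Algebra.IsQuadraticExtension ℚ F] {J : Ideal (𝓞 F)}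
    (hJ : J ≠ ⊥) {k : ℕ} (hk : k ≠ 0) : Finite (generatingSublattices J k) :=
  have := finite_sublatticesOfIdeal hJ hk
  Finite.of_injective (fun K : generatingSublattices J k =>
    (⟨K.1, le_of_mem_generatingSublattices K.2, K.2.2⟩ : sublatticesOfIdeal J k))
    fun _ _ h => Subtype.ext (congrArg (fun H : sublatticesOfIdeal J k => H.1) h)

theorem ne_bot_of_absNorm_eq {I : Ideal (𝓞 F)} {m : ℕ} {p : ℕ × ℕ} (hp : p ∈ m.divisorsAntidiagonal)
    (h : Ideal.absNorm I = p.1) : I ≠ ⊥ := by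
  rintro rfl
  rw [Ideal.absNorm_bot] at h
  exact (Nat.pos_of_mem_divisors (Nat.fst_mem_divisors_of_mem_antidiagonal hp)).ne h

instance finite_absNorm_eq (n : ℕ) : Finite {I : Ideal (𝓞 F) // Ideal.absNorm I = n} :=
  Ideal.finite_setOfPred_absNorm_eq n

theorem sum_card_generatingSublattices [Algebra.IsQuadraticExtension ℚ F] {J : Ideal (𝓞 F)}
    (hJ : J ≠ ⊥) {m : ℕ} (hm : m ≠ 0) :
    ∑ p ∈ m.divisorsAntidiagonal, ∑ᶠ I : {I : Ideal (𝓞 F) // Ideal.absNorm I = p.1},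
      Nat.card (generatingSublattices (J * I.1) p.2) = σ 1 m := by
  rw [← card_sublatticesOfIdeal hJ hm]
  let f : (Σ p : m.divisorsAntidiagonal, Σ I : {I : Ideal (𝓞 F) // Ideal.absNorm I = p.1.1},
      generatingSublattices (J * I.1) p.1.2) → sublatticesOfIdeal J m := fun x =>
    ⟨x.2.2, by
      obtain ⟨⟨p, hp⟩, ⟨I, hI⟩, ⟨K, hK⟩⟩ := x
      have := mem_sublatticesOfIdeal_of_mem_generatingSublattices hJ (ne_bot_of_absNorm_eq hp hI) hK
      rwa [hI, (Nat.mem_divisorsAntidiagonal.mp hp).1] at this⟩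
  have hf : Function.Bijective f := by
    constructor
    · rintro ⟨⟨p, hp⟩, ⟨I, hI⟩, ⟨K, hK⟩⟩ ⟨⟨p', hp'⟩, ⟨I', hI'⟩, ⟨K', hK'⟩⟩ h
      obtain rfl : K = K' := congrArg Subtype.val h
      obtain rfl : I = I' := mul_left_cancel₀ hJ (hK.1.symm.trans hK'.1)
      obtain rfl : p = p' := Prod.ext (hI.symm.trans hI') (hK.2.symm.trans hK'.2)
      rfl
    · rintro ⟨K, hK⟩
      obtain ⟨I, k, hI, hk, h⟩ := exists_mem_generatingSublattices hJ hm hK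
      exact ⟨⟨⟨(_, k), Nat.mem_divisorsAntidiagonal.mpr ⟨hk, hm⟩⟩, ⟨I, rfl⟩, ⟨K, h⟩⟩, rfl⟩
  have hfin : ∀ (p : m.divisorsAntidiagonal) (I : {I : Ideal (𝓞 F) // Ideal.absNorm I = p.1.1}),
      Finite (generatingSublattices (J * I.1) p.1.2) := fun p I =>
    finite_generatingSublattices (mul_ne_zero hJ (ne_bot_of_absNorm_eq p.2 I.2))
      (Nat.pos_of_mem_divisors (Nat.snd_mem_divisors_of_mem_antidiagonal p.2)).ne'
  rw [← Nat.card_congr (Equiv.ofBijective f hf), Nat.card_sigma, ← Finset.sum_coe_sort]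
  refine Finset.sum_congr rfl fun p _ => ?_
  have := Fintype.ofFinite {I : Ideal (𝓞 F) // Ideal.absNorm I = p.1.1}
  rw [Nat.card_sigma, finsum_eq_sum_of_fintype]

/-- The identity with right-hand side `σ 1 k` holds for every nonzero ideal and is triangular in the
generating counts, so these are determined recursively without reference to `J`. -/
theorem card_generatingSublattices_eq [Algebra.IsQuadraticExtension ℚ F] {J : Ideal (𝓞 F)}
    (hJ : J ≠ ⊥) {k : ℕ} (hk : k ≠ 0) :
    Nat.card (generatingSublattices J k) =
      Nat.card (generatingSublattices (⊤ : Ideal (𝓞 F)) k) := by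
  induction k using Nat.strong_induction_on generalizing J with
  | _ k ih =>
    have h1 := sum_card_generatingSublattices hJ hk
    have h2 := sum_card_generatingSublattices (J := (⊤ : Ideal (𝓞 F))) top_ne_bot hk
    have hmem : (1, k) ∈ k.divisorsAntidiagonal := by simp [hk]
    rw [← Finset.add_sum_erase _ _ hmem] at h1 h2
    -- Only `⊤` has norm one, so the term `(1, k)` is the unknown itself; all other terms have index
    -- below `k`.
    have hone : ∀ J : Ideal (𝓞 F), ∑ᶠ I : {I : Ideal (𝓞 F) // Ideal.absNorm I = 1},
        Nat.card (generatingSublattices (J * I.1) k) = Nat.card (generatingSublattices J k) := by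
      intro J
      rw [finsum_eq_single _ ⟨⊤, Ideal.absNorm_top⟩, Ideal.mul_top]
      rintro ⟨I, hI⟩ h
      exact absurd (Subtype.ext (Ideal.absNorm_eq_one_iff.mp hI)) h
    simp only [hone] at h1 h2
    have hrest : ∀ J : Ideal (𝓞 F), J ≠ ⊥ → ∀ p ∈ k.divisorsAntidiagonal.erase (1, k),
        ∑ᶠ I : {I : Ideal (𝓞 F) // Ideal.absNorm I = p.1},
          Nat.card (generatingSublattices (J * I.1) p.2) =
        ∑ᶠ I : {I : Ideal (𝓞 F) // Ideal.absNorm I = p.1},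
          Nat.card (generatingSublattices (⊤ : Ideal (𝓞 F)) p.2) := by
      intro J hJ p hp
      obtain ⟨hne, hp⟩ := Finset.mem_erase.mp hp
      have hp2 := Nat.snd_mem_divisors_of_mem_antidiagonal hp
      refine finsum_congr fun I => ih _ (lt_of_le_of_ne (Nat.divisor_le hp2) ?_)
        (mul_ne_zero hJ (ne_bot_of_absNorm_eq hp I.2)) (Nat.pos_of_mem_divisors hp2).ne'
      rintro h
      refine hne (Prod.ext ?_ h)
      have := (Nat.mem_divisorsAntidiagonal.mp hp).1
      rw [h] at this
      exact Nat.eq_of_mul_eq_mul_right (Nat.pos_of_ne_zero hk) (by rw [this, one_mul])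
    rw [Finset.sum_congr rfl (hrest J hJ)] at h1
    rw [Finset.sum_congr rfl (hrest ⊤ top_ne_bot)] at h2
    omega

/-- The number of subgroups of index `k` in the ring of integers that generate the unit ideal. -/
noncomputable def generatingCount (F : Type*) [Field F] [NumberField F] (k : ℕ) : ℕ :=
  Nat.card (generatingSublattices (⊤ : Ideal (𝓞 F)) k)

theorem sum_idealCount_mul_generatingCount [Algebra.IsQuadraticExtension ℚ F] {m : ℕ}
    (hm : m ≠ 0) :
    ∑ p ∈ m.divisorsAntidiagonal, Nat.card {I : Ideal (𝓞 F) // Ideal.absNorm I = p.1} *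
      generatingCount F p.2 = σ 1 m := by
  rw [← sum_card_generatingSublattices (J := (⊤ : Ideal (𝓞 F))) top_ne_bot hm]
  refine Finset.sum_congr rfl fun p hp => ?_
  have := Fintype.ofFinite {I : Ideal (𝓞 F) // Ideal.absNorm I = p.1}
  rw [finsum_eq_sum_of_fintype, Finset.sum_congr rfl (g := fun _ => generatingCount F p.2)]
  · rw [Finset.sum_const, smul_eq_mul, Finset.card_univ, Nat.card_eq_fintype_card]
  · intro I _
    exact card_generatingSublattices_eq (mul_ne_zero top_ne_bot (ne_bot_of_absNorm_eq hp I.2))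
      (Nat.pos_of_mem_divisors (Nat.snd_mem_divisors_of_mem_antidiagonal hp)).ne'

end Sublattices

end BinaryLattice

namespace BinaryLattice

open ArithmeticFunction ArithmeticFunction.sigma NumberField
open scoped nonZeroDivisors Pointwise

/-! ### Unit orbits and classes under scaling. -/

section Orbits

variable {F : Type*} [Field F]

/-- The multipliers preserving `K` form a ring; if it contains a ring generator of `𝓞 F`, then `K`
is an ideal. -/
theorem span_toAddSubgroup_eq_of_smul_eq {K : AddSubgroup (𝓞 F)} {u : (𝓞 F)ˣ}
    (hu : Algebra.adjoin ℤ {(u : 𝓞 F)} = ⊤) (h : u • K = K) :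
    (Ideal.span (K : Set (𝓞 F))).toAddSubgroup = K := by
  have hmul : ∀ x : 𝓞 F, ∀ y ∈ K, x * y ∈ K := by
    intro x
    have hx : x ∈ Algebra.adjoin ℤ {(u : 𝓞 F)} := hu ▸ Algebra.mem_top
    induction hx using Algebra.adjoin_induction with
    | mem x hx =>
      obtain rfl := hx
      intro y hy
      rw [← h]
      exact AddSubgroup.smul_mem_pointwise_smul y u K hy
    | algebraMap r =>
      intro y hy
      rw [← Algebra.smul_def]
      exact K.zsmul_mem hy r
    | add x x' _ _ hx hx' => exact fun y hy => by rw [add_mul]; exact K.add_mem (hx y hy) (hx' y hy)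
    | mul x x' _ _ hx hx' => exact fun y hy => by rw [mul_assoc]; exact hx _ (hx' y hy)
  refine le_antisymm ?_ Ideal.subset_span
  let I : Ideal (𝓞 F) := { K with smul_mem' := hmul }
  exact Ideal.span_le (I := I).mpr le_rfl

theorem card_fixedBy_generatingSublattices {J : Ideal (𝓞 F)} {k : ℕ} {u : (𝓞 F)ˣ}
    (hu : Algebra.adjoin ℤ {(u : 𝓞 F)} = ⊤) :
    Nat.card (MulAction.fixedBy (generatingSublattices J k) u) = if k = 1 then 1 else 0 := by
  have key : ∀ K : generatingSublattices J k, K ∈ MulAction.fixedBy (generatingSublattices J k) u →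
      (K : AddSubgroup (𝓞 F)) = J.toAddSubgroup := by
    intro K hK
    rw [← span_toAddSubgroup_eq_of_smul_eq hu (congrArg Subtype.val hK), K.2.1]
  split_ifs with hk
  · rw [Nat.card_eq_one_iff_unique]
    refine ⟨⟨fun K K' => Subtype.ext (Subtype.ext ((key _ K.2).trans (key _ K'.2).symm))⟩,
      ⟨⟨⟨J.toAddSubgroup, Ideal.span_eq J, ?_⟩, ?_⟩⟩⟩
    · rw [hk, AddSubgroup.relIndex_self]
    · refine Subtype.ext ?_
      change (u : 𝓞 F) • J.toAddSubgroup = _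
      rw [smul_ideal_toAddSubgroup, Ideal.span_singleton_eq_top.mpr u.isUnit, Ideal.top_mul]
  · rw [Nat.card_eq_zero]
    refine Or.inl ⟨fun K => hk ?_⟩
    rw [← K.1.2.2, key _ K.2, AddSubgroup.relIndex_self]

variable [NumberField F]

theorem two_le_card_units [Finite (𝓞 F)ˣ] : 2 ≤ Nat.card (𝓞 F)ˣ := by
  classical
  have := Fintype.ofFinite (𝓞 F)ˣ
  have h : (1 : (𝓞 F)ˣ) ≠ -1 := fun h => by
    have := congrArg Units.val h
    simp only [Units.val_one, Units.val_neg] at this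
    exact absurd this (by norm_num)
  rw [Nat.card_eq_fintype_card, ← Finset.card_pair h]
  exact Finset.card_le_univ _

/-- Burnside's lemma: `1` and `-1` fix everything, and each of the other units fixes only `J`
itself, which occurs exactly when `k = 1`. -/
theorem card_orbits_generatingSublattices [Algebra.IsQuadraticExtension ℚ F] [Finite (𝓞 F)ˣ]
    (hu : ∀ u : (𝓞 F)ˣ, u ≠ 1 → u ≠ -1 → Algebra.adjoin ℤ {(u : 𝓞 F)} = ⊤)
    {J : Ideal (𝓞 F)} (hJ : J ≠ ⊥) {k : ℕ} (hk : k ≠ 0) :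
    Nat.card (𝓞 F)ˣ * Nat.card (MulAction.orbitRel.Quotient (𝓞 F)ˣ (generatingSublattices J k)) =
      2 * generatingCount F k + (Nat.card (𝓞 F)ˣ - 2) * if k = 1 then 1 else 0 := by
  classical
  have := finite_generatingSublattices hJ hk
  have := Fintype.ofFinite (𝓞 F)ˣ
  have := fun u : (𝓞 F)ˣ =>
    Fintype.ofFinite (MulAction.fixedBy (generatingSublattices J k) u)
  have := Fintype.ofFinite (MulAction.orbitRel.Quotient (𝓞 F)ˣ (generatingSublattices J k))
  have hne : (1 : (𝓞 F)ˣ) ≠ -1 := fun h => by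
    have := congrArg Units.val h
    simp only [Units.val_one, Units.val_neg] at this
    exact absurd this (by norm_num)
  have burnside := MulAction.sum_card_fixedBy_eq_card_orbits_mul_card_group (𝓞 F)ˣ
    (generatingSublattices J k)
  rw [Nat.card_eq_fintype_card, Nat.card_eq_fintype_card, mul_comm, ← burnside,
    ← Finset.sum_sdiff (Finset.subset_univ {1, -1}), Finset.sum_pair hne, add_comm]
  congr 1
  · have h : ∀ u : (𝓞 F)ˣ, (∀ K : AddSubgroup (𝓞 F), u • K = K) →
        Fintype.card (MulAction.fixedBy (generatingSublattices J k) u) = generatingCount F k := by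
      intro u hu
      rw [← Nat.card_eq_fintype_card, generatingCount, ← card_generatingSublattices_eq hJ hk,
        show MulAction.fixedBy (generatingSublattices J k) u = Set.univ from
          Set.eq_univ_of_forall fun K => Subtype.ext (hu K.1), Nat.card_congr (Equiv.Set.univ _)]
    rw [h 1 (one_smul _), h (-1) (fun K => ?_), two_mul]
    rw [← coe_smul_addSubgroup]
    ext x
    rw [AddSubgroup.mem_smul_pointwise_iff_exists]
    refine ⟨?_, fun hx => ⟨-x, K.neg_mem hx, ?_⟩⟩
    · rintro ⟨y, hy, rfl⟩
      rw [Units.val_neg, Units.val_one, neg_smul, one_smul]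
      exact K.neg_mem hy
    · rw [Units.val_neg, Units.val_one, neg_smul, one_smul, neg_neg]
  · rw [Finset.sum_congr rfl (g := fun _ => if k = 1 then 1 else 0), Finset.sum_const,
      Finset.card_sdiff_of_subset (Finset.subset_univ _), Finset.card_univ, Finset.card_pair hne,
      smul_eq_mul]
    intro u hu'
    rw [← Nat.card_eq_fintype_card]
    simp only [Finset.mem_sdiff, Finset.mem_univ, Finset.mem_insert, Finset.mem_singleton,
      true_and, not_or] at hu'
    exact card_fixedBy_generatingSublattices (hu u hu'.1 hu'.2)

/-- Two subgroups of an ideal are equivalent if they agree up to multiplication by nonzero elements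
of the field. -/
def scalingSetoid (J : Ideal (𝓞 F)) (m : ℕ) : Setoid (sublatticesOfIdeal J m) where
  r K K' := ∃ x y : 𝓞 F, x ≠ 0 ∧ y ≠ 0 ∧ x • (K : AddSubgroup (𝓞 F)) = y • K'
  iseqv :=
    { refl := fun K => ⟨1, 1, one_ne_zero, one_ne_zero, rfl⟩
      symm := fun ⟨x, y, hx, hy, h⟩ => ⟨y, x, hy, hx, h.symm⟩
      trans := by
        rintro K K' K'' ⟨x, y, hx, hy, h⟩ ⟨x', y', hx', hy', h'⟩
        refine ⟨x' * x, y * y', mul_ne_zero hx' hx, mul_ne_zero hy hy', ?_⟩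
        rw [mul_smul, h, smul_smul, mul_comm, mul_smul, h', smul_smul] }

theorem absNorm_eq_of_smul_eq {J : Ideal (𝓞 F)} (hJ : J ≠ ⊥) {m : ℕ} (hm : m ≠ 0)
    {K K' : AddSubgroup (𝓞 F)} (hK : K ∈ sublatticesOfIdeal J m) (hK' : K' ∈ sublatticesOfIdeal J m)
    {x y : 𝓞 F} (hx : x ≠ 0) (hy : y ≠ 0) (h : x • K = y • K') :
    Ideal.absNorm (Ideal.span {x}) = Ideal.absNorm (Ideal.span {y}) := by
  have h1 := congrArg AddSubgroup.index h
  rw [index_smul hx, index_smul hy, ((mem_sublatticesOfIdeal_iff_index hJ).mp hK).2,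
    ((mem_sublatticesOfIdeal_iff_index hJ).mp hK').2] at h1
  exact Nat.eq_of_mul_eq_mul_left
    (Nat.pos_of_ne_zero (mul_ne_zero hm (Ideal.absNorm_eq_zero_iff.not.mpr hJ))) h1

/-- The ideal classes that contain an integral ideal of norm `n`. -/
def classesOfNorm (F : Type*) [Field F] [NumberField F] (n : ℕ) : Set (ClassGroup (𝓞 F)) :=
  {c | ∃ J : (Ideal (𝓞 F))⁰, Ideal.absNorm (J : Ideal (𝓞 F)) = n ∧ ClassGroup.mk0 J = c}

/-- An integral ideal of norm `n` in a class that contains one. -/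
noncomputable def representative {n : ℕ} (c : classesOfNorm F n) : (Ideal (𝓞 F))⁰ := c.2.choose

theorem absNorm_representative {n : ℕ} (c : classesOfNorm F n) :
    Ideal.absNorm (representative c : Ideal (𝓞 F)) = n := c.2.choose_spec.1

theorem mk0_representative {n : ℕ} (c : classesOfNorm F n) :
    ClassGroup.mk0 (representative c) = c := c.2.choose_spec.2

theorem representative_ne_bot {n : ℕ} (c : classesOfNorm F n) :
    (representative c : Ideal (𝓞 F)) ≠ ⊥ := nonZeroDivisors.coe_ne_zero _

/-- Multiplication by `x / y` takes `J` to `I`, hence generating subgroups of `J` to those of `I`;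
it moves a subgroup to the chosen representative of its ideal class. -/
theorem exists_smul_eq_mem_generatingSublattices {J I : Ideal (𝓞 F)} {k : ℕ}
    {K : AddSubgroup (𝓞 F)} (hK : K ∈ generatingSublattices J k) {x y : 𝓞 F} (hx : x ≠ 0)
    (hy : y ≠ 0) (h : Ideal.span {x} * J = Ideal.span {y} * I) :
    ∃ K' ∈ generatingSublattices I k, x • K = y • K' := by
  have hle : x • K ≤ y • I.toAddSubgroup := by
    rw [smul_ideal_toAddSubgroup, ← h, ← smul_ideal_toAddSubgroup]
    exact AddSubgroup.map_mono (le_of_mem_generatingSublattices hK)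
  obtain ⟨K', hK'⟩ : ∃ K' : AddSubgroup (𝓞 F), x • K = y • K' := by
    refine ⟨(x • K).comap (DistribSMul.toAddMonoidHom (𝓞 F) y), ?_⟩
    refine Eq.symm (AddSubgroup.map_comap_eq_self (hle.trans ?_))
    rintro _ ⟨z, -, rfl⟩
    exact ⟨z, rfl⟩
  have hspan := congrArg (fun H : AddSubgroup (𝓞 F) => Ideal.span (H : Set (𝓞 F))) hK'
  simp only [span_smul_addSubgroup, hK.1, h] at hspan
  refine ⟨K', ⟨(mul_left_cancel₀ (by simpa using hy) hspan).symm, ?_⟩, hK'⟩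
  rw [← relIndex_smul_smul hy, ← hK', smul_ideal_toAddSubgroup, ← h, ← smul_ideal_toAddSubgroup,
    relIndex_smul_smul hx, hK.2]

/-- A scaling class determines the norm and the class of the quotient ideal `I`. Once `I` is the
fixed representative, the scalars that remain are units. -/
theorem card_quotient_scalingSetoid [Algebra.IsQuadraticExtension ℚ F] {J : Ideal (𝓞 F)}
    (hJ : J ≠ ⊥) {m : ℕ} (hm : m ≠ 0) :
    Nat.card (Quotient (scalingSetoid J m)) =
      ∑ p ∈ m.divisorsAntidiagonal, ∑ᶠ c : classesOfNorm F p.1,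
        Nat.card (MulAction.orbitRel.Quotient (𝓞 F)ˣ
          (generatingSublattices (J * (representative c).1) p.2)) := by
  have hmem : ∀ (p : m.divisorsAntidiagonal) (c : classesOfNorm F p.1.1)
      (K : generatingSublattices (J * (representative c).1) p.1.2),
      (K : AddSubgroup (𝓞 F)) ∈ sublatticesOfIdeal J m := by
    intro p c K
    have := mem_sublatticesOfIdeal_of_mem_generatingSublattices hJ (representative_ne_bot c) K.2
    rwa [absNorm_representative, (Nat.mem_divisorsAntidiagonal.mp p.2).1] at this
  let f : (Σ p : m.divisorsAntidiagonal, Σ c : classesOfNorm F p.1.1,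
      MulAction.orbitRel.Quotient (𝓞 F)ˣ
        (generatingSublattices (J * (representative c).1) p.1.2)) → Quotient (scalingSetoid J m) :=
    fun x => Quotient.map' (s₂ := scalingSetoid J m)
      (fun K : generatingSublattices (J * (representative x.2.1).1) x.1.1.2 =>
        (⟨K, hmem x.1 x.2.1 K⟩ : sublatticesOfIdeal J m))
      (by
        rintro K K' ⟨u, rfl⟩
        exact ⟨1, u, one_ne_zero, u.ne_zero, one_smul _ _⟩) x.2.2
  have hf : Function.Bijective f := by
    constructor
    · rintro ⟨p, c, q⟩ ⟨p', c', q'⟩ h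
      induction q using Quotient.inductionOn' with | _ K
      induction q' using Quotient.inductionOn' with | _ K'
      obtain ⟨x, y, hx, hy, hxy⟩ : (scalingSetoid J m).r ⟨K, hmem p c K⟩ ⟨K', hmem p' c' K'⟩ :=
        Quotient.exact h
      simp only at hxy
      -- Comparing norms of the generated ideals gives `n = n'`, comparing their classes gives `c =
      -- c'`, and cancelling the common ideal makes `x` and `y` associated.
      have hN := absNorm_eq_of_smul_eq hJ hm (hmem p c K) (hmem p' c' K') hx hy hxy
      have hspan := congrArg (fun H : AddSubgroup (𝓞 F) => Ideal.span (H : Set (𝓞 F))) hxy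
      simp only [span_smul_addSubgroup, K.2.1, K'.2.1] at hspan
      have hspan' : Ideal.span {x} * (representative c : Ideal (𝓞 F)) =
          Ideal.span {y} * (representative c' : Ideal (𝓞 F)) :=
        mul_left_cancel₀ hJ (by rw [mul_left_comm, hspan, mul_left_comm])
      obtain ⟨⟨n, k⟩, hp⟩ := p
      obtain ⟨⟨n', k'⟩, hp'⟩ := p'
      obtain rfl : n = n' := by
        have := congrArg Ideal.absNorm hspan'
        rw [map_mul, map_mul, absNorm_representative, absNorm_representative, hN] at this
        refine Nat.eq_of_mul_eq_mul_left (Nat.pos_of_ne_zero ?_) this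
        rw [Ne, Ideal.absNorm_eq_zero_iff]
        simpa using hy
      obtain rfl : k = k' := by
        refine Nat.eq_of_mul_eq_mul_left
          (Nat.pos_of_mem_divisors (Nat.fst_mem_divisors_of_mem_antidiagonal hp))
          ((Nat.mem_divisorsAntidiagonal.mp hp).1.trans
            (Nat.mem_divisorsAntidiagonal.mp hp').1.symm)
      obtain rfl : c = c' := by
        refine Subtype.ext ?_
        rw [← mk0_representative c, ← mk0_representative c', ClassGroup.mk0_eq_mk0_iff]
        exact ⟨x, y, hx, hy, hspan'⟩
      congr 2
      have hassoc : Associated x y := by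
        rw [← Ideal.span_singleton_eq_span_singleton]
        exact mul_right_cancel₀ (representative_ne_bot c) hspan'
      obtain ⟨u, rfl⟩ := hassoc
      refine Quotient.sound' ⟨u, Subtype.ext (smul_addSubgroup_injective hx ?_)⟩
      change x • ((u : 𝓞 F) • (K' : AddSubgroup (𝓞 F))) = x • (K : AddSubgroup (𝓞 F))
      rw [hxy, mul_smul]
    · intro q
      induction q using Quotient.inductionOn' with | _ K
      obtain ⟨I, k, hI, hk, hK⟩ := exists_mem_generatingSublattices hJ hm K.2
      let I' : (Ideal (𝓞 F))⁰ := ⟨I, mem_nonZeroDivisors_of_ne_zero hI⟩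
      let c : classesOfNorm F (Ideal.absNorm I) := ⟨ClassGroup.mk0 I', I', rfl, rfl⟩
      obtain ⟨x, y, hx, hy, h⟩ := (ClassGroup.mk0_eq_mk0_iff (I := I')).mp
        (mk0_representative c).symm
      obtain ⟨K', hK', hKK'⟩ := exists_smul_eq_mem_generatingSublattices hK hx hy
        (I := J * (representative c).1) (by
          rw [mul_left_comm, mul_left_comm (Ideal.span {y}), ← h])
      refine ⟨⟨⟨(_, k), Nat.mem_divisorsAntidiagonal.mpr ⟨hk, hm⟩⟩, c,
        Quotient.mk'' ⟨K', hK'⟩⟩, ?_⟩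
      exact Quotient.sound' ⟨y, x, hy, hx, hKK'.symm⟩
  have hfin : ∀ (p : m.divisorsAntidiagonal) (c : classesOfNorm F p.1.1),
      Finite (MulAction.orbitRel.Quotient (𝓞 F)ˣ
        (generatingSublattices (J * (representative c).1) p.1.2)) := fun p c =>
    have := finite_generatingSublattices (mul_ne_zero hJ (representative_ne_bot c))
      (Nat.pos_of_mem_divisors (Nat.snd_mem_divisors_of_mem_antidiagonal p.2)).ne'
    Quotient.finite _
  rw [← Nat.card_congr (Equiv.ofBijective f hf), Nat.card_sigma,
    ← Finset.sum_coe_sort m.divisorsAntidiagonal]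
  refine Finset.sum_congr rfl fun p _ => ?_
  have := Fintype.ofFinite (classesOfNorm F p.1.1)
  rw [Nat.card_sigma, finsum_eq_sum_of_fintype]

theorem card_units_mul_card_quotient_scalingSetoid [Algebra.IsQuadraticExtension ℚ F]
    [Finite (𝓞 F)ˣ] (hu : ∀ u : (𝓞 F)ˣ, u ≠ 1 → u ≠ -1 → Algebra.adjoin ℤ {(u : 𝓞 F)} = ⊤)
    {J : Ideal (𝓞 F)} (hJ : J ≠ ⊥) {m : ℕ} (hm : m ≠ 0) :
    Nat.card (𝓞 F)ˣ * Nat.card (Quotient (scalingSetoid J m)) =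
      ∑ p ∈ m.divisorsAntidiagonal, classCountOfNorm F p.1 *
        (2 * generatingCount F p.2 + (Nat.card (𝓞 F)ˣ - 2) * if p.2 = 1 then 1 else 0) := by
  rw [card_quotient_scalingSetoid hJ hm, Finset.mul_sum]
  refine Finset.sum_congr rfl fun p hp => ?_
  have := Fintype.ofFinite (classesOfNorm F p.1)
  rw [finsum_eq_sum_of_fintype, Finset.mul_sum, Finset.sum_congr rfl fun c _ =>
    card_orbits_generatingSublattices hu (mul_ne_zero hJ (representative_ne_bot c))
      (Nat.pos_of_mem_divisors (Nat.snd_mem_divisors_of_mem_antidiagonal hp)).ne',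
    Finset.sum_const, smul_eq_mul, Finset.card_univ, ← Nat.card_eq_fintype_card]
  rfl

end Orbits

end BinaryLattice

namespace BinaryLattice

open NumberField
open scoped nonZeroDivisors Pointwise

/-! ### Integral bases, units and class number of imaginary quadratic fields. -/

section QuadraticBasis

theorem leftMulMatrix_quadratic {R S : Type*} [CommRing R] [CommRing S] [Algebra R S]
    (b : Module.Basis (Fin 2) R S) (h0 : b 0 = 1) {β γ : R}
    (h1 : b 1 * b 1 = β • b 1 - γ • 1) (x y : R) :
    Algebra.leftMulMatrix b (x • 1 + y • b 1) = !![x, -(γ * y); y, x + β * y] := by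
  have h2 : (x • 1 + y • b 1) * b 0 = x • b 0 + y • b 1 := by rw [h0, mul_one]
  have h3 : (x • 1 + y • b 1) * b 1 = (-(γ * y)) • b 0 + (x + β * y) • b 1 := by
    rw [add_mul, smul_mul_assoc, smul_mul_assoc, h1, h0, one_mul]
    module
  ext i j
  rw [Algebra.leftMulMatrix_eq_repr_mul]
  fin_cases j
  · simp only [Fin.zero_eta, h2]
    fin_cases i <;> simp
  · simp only [Fin.mk_one, h3]
    fin_cases i <;> simp

theorem norm_quadratic {R S : Type*} [CommRing R] [CommRing S] [Algebra R S]
    (b : Module.Basis (Fin 2) R S) (h0 : b 0 = 1) {β γ : R}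
    (h1 : b 1 * b 1 = β • b 1 - γ • 1) (x y : R) :
    Algebra.norm R (x • 1 + y • b 1) = x ^ 2 + β * x * y + γ * y ^ 2 := by
  rw [Algebra.norm_eq_matrix_det b, leftMulMatrix_quadratic b h0 h1, Matrix.det_fin_two_of]
  ring

theorem trace_quadratic {R S : Type*} [CommRing R] [CommRing S] [Algebra R S]
    (b : Module.Basis (Fin 2) R S) (h0 : b 0 = 1) {β γ : R}
    (h1 : b 1 * b 1 = β • b 1 - γ • 1) (x y : R) :
    Algebra.trace R S (x • 1 + y • b 1) = 2 * x + β * y := by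
  rw [Algebra.trace_eq_matrix_trace b, leftMulMatrix_quadratic b h0 h1, Matrix.trace_fin_two_of]
  ring

theorem discr_quadratic {R S : Type*} [CommRing R] [CommRing S] [Algebra R S]
    (b : Module.Basis (Fin 2) R S) (h0 : b 0 = 1) {β γ : R}
    (h1 : b 1 * b 1 = β • b 1 - γ • 1) : Algebra.discr R b = β ^ 2 - 4 * γ := by
  have t1 : Algebra.trace R S 1 = 2 := by simpa using trace_quadratic b h0 h1 1 0
  have t2 : Algebra.trace R S (b 1) = β := by simpa using trace_quadratic b h0 h1 0 1
  rw [Algebra.discr_def, Matrix.det_fin_two]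
  simp only [Algebra.traceMatrix_apply, Algebra.traceForm_apply, h0, h1, one_mul, mul_one, t1, t2,
    map_sub, map_smul, smul_eq_mul]
  ring

variable {F : Type*} [Field F]

theorem eq_repr_quadratic (b : Module.Basis (Fin 2) ℤ (𝓞 F)) (h0 : b 0 = 1) (z : 𝓞 F) :
    z = b.repr z 0 • 1 + b.repr z 1 • b 1 := by
  conv_lhs => rw [← b.sum_repr z, Fin.sum_univ_two, h0]

variable [NumberField F]

theorem isUnit_of_isUnit_intCast {p : ℤ} (h : IsUnit (p : 𝓞 F)) : IsUnit p := by
  have := h.map (Algebra.norm ℤ)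
  rw [← eq_intCast (algebraMap ℤ (𝓞 F)), Algebra.norm_algebraMap] at this
  exact (isUnit_pow_iff Module.finrank_pos.ne').mp this

/-- The left side is four times the norm after completing the square. It is nonnegative for negative
discriminant, which excludes norm `-1`. -/
theorem four_eq_of_unit (hneg : discr F < 0) {β γ : ℤ} {b : Module.Basis (Fin 2) ℤ (𝓞 F)}
    (h0 : b 0 = 1) (h1 : b 1 * b 1 = β • b 1 - γ • 1) (u : (𝓞 F)ˣ) :
    (2 * b.repr u 0 + β * b.repr u 1) ^ 2 - discr F * b.repr u 1 ^ 2 = 4 := by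
  have hD : discr F = β ^ 2 - 4 * γ := by rw [← discr_quadratic b h0 h1, discr_eq_discr]
  have hN := norm_quadratic b h0 h1 (b.repr u 0) (b.repr u 1)
  rw [← eq_repr_quadratic b h0] at hN
  have hu : IsUnit (Algebra.norm ℤ (u : 𝓞 F)) := u.isUnit.map _
  have h4 : (2 * b.repr u 0 + β * b.repr u 1) ^ 2 - discr F * b.repr u 1 ^ 2 =
    4 * Algebra.norm ℤ (u : 𝓞 F) := by rw [hN, hD]; ring
  rcases Int.isUnit_iff.mp hu with h | h
  · rw [h4, h, mul_one]
  · rw [h] at h4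
    nlinarith [sq_nonneg (2 * b.repr u 0 + β * b.repr u 1), sq_nonneg (b.repr u 1)]

variable [Algebra.IsQuadraticExtension ℚ F]

/-- The ring of integers of a quadratic field has a basis of the form `1, θ`. -/
theorem exists_basis_zero_eq_one :
    ∃ b : Module.Basis (Fin 2) ℤ (𝓞 F), b 0 = 1 := by
  let e := Module.finBasisOfFinrankEq ℤ (𝓞 F) finrank_int_ringOfIntegers_eq_two
  set p := e.repr 1 0 with hp
  set q := e.repr 1 1 with hq
  have hone : (1 : 𝓞 F) = p • e 0 + q • e 1 := by
    rw [← Fin.sum_univ_two (fun i => e.repr 1 i • e i), e.sum_repr]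
  -- The gcd of the coordinates of `1` divides `1` in `𝓞 F`. Bézout coefficients then complete `1`
  -- to a basis of determinant one.
  have hgcd : IsUnit ((Int.gcd p q : ℤ)) := by
    refine isUnit_of_isUnit_intCast (F := F) ?_
    obtain ⟨p', hp'⟩ := Int.gcd_dvd_left p q
    obtain ⟨q', hq'⟩ := Int.gcd_dvd_right p q
    refine IsUnit.of_mul_eq_one (p' • e 0 + q' • e 1) ?_
    generalize (Int.gcd p q : ℤ) = g at hp' hq'
    rw [hone, hp', hq', ← zsmul_eq_mul, smul_add, smul_smul, smul_smul]
  obtain ⟨u, v, huv⟩ : ∃ u v : ℤ, p * u + q * v = 1 :=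
by
    obtain ⟨u, v, h⟩ : IsCoprime p q := by
      rw [Int.isCoprime_iff_gcd_eq_one]
      exact Int.ofNat_isUnit.mp hgcd |> Nat.isUnit_iff.mp
    exact ⟨u, v, by linarith⟩
  have hdet : IsUnit (e.det ![1, (-v) • e 0 + u • e 1]) := by
    rw [Module.Basis.det_apply, Matrix.det_fin_two]
    simp [-zsmul_eq_mul, Module.Basis.toMatrix_apply, ← hp, ← hq, mul_comm v q, huv]
  obtain ⟨hli, hsp⟩ := (Module.Basis.is_basis_iff_det e).mpr hdet
  exact ⟨Module.Basis.mk hli hsp.ge, by simp⟩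

theorem exists_quadratic_basis : ∃ (β γ : ℤ) (b : Module.Basis (Fin 2) ℤ (𝓞 F)), b 0 = 1 ∧
    b 1 * b 1 = β • b 1 - γ • 1 ∧ discr F = β ^ 2 - 4 * γ := by
  obtain ⟨b, hb⟩ := exists_basis_zero_eq_one (F := F)
  have h : b 1 * b 1 = b.repr (b 1 * b 1) 1 • b 1 - (- b.repr (b 1 * b 1) 0) • 1 := by
    conv_lhs => rw [← b.sum_repr (b 1 * b 1), Fin.sum_univ_two, hb]
    module
  exact ⟨_, _, b, hb, h, by rw [← discr_quadratic b hb h, discr_eq_discr]⟩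

/-- Equal discriminants force `β` and `t` to have the same parity, and the translation of `b 1` by
`k = (β - t) / 2` changes its trace from `t` to `β`; the discriminant then fixes the norm. -/
theorem exists_quadratic_basis_of_eq_discr {β γ : ℤ} (h : discr F = β ^ 2 - 4 * γ) :
    ∃ b : Module.Basis (Fin 2) ℤ (𝓞 F), b 0 = 1 ∧ b 1 * b 1 = β • b 1 - γ • 1 := by
  obtain ⟨t, n, b, h0, h1, hD⟩ := exists_quadratic_basis (F := F)
  have hpar : Even (β - t) := by
    have : Even ((β - t) * (β + t)) := ⟨2 * (γ - n), by linear_combination hD - h⟩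
    rcases Int.even_mul.mp this with h | h
    · exact h
    · exact Int.even_sub.mpr (Int.even_add.mp h)
  obtain ⟨k, hk⟩ := hpar
  have hγ : γ = k * k + k * t + n := by
    obtain rfl : β = t + (k + k) := by linarith
    have : 4 * γ = 4 * (k * k + k * t + n) := by linear_combination h - hD
    linarith
  have hdet : IsUnit (b.det ![1, k • 1 + b 1]) := by
    rw [← h0, Module.Basis.det_apply, Matrix.det_fin_two]
    simp [-zsmul_eq_mul, Module.Basis.toMatrix_apply]
  obtain ⟨hli, hsp⟩ := (Module.Basis.is_basis_iff_det b).mpr hdet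
  refine ⟨Module.Basis.mk hli hsp.ge, by simp, ?_⟩
  simp only [Module.Basis.mk_apply, Matrix.cons_val_one, Matrix.cons_val_fin_one, add_mul,
    mul_add, h1, hγ, show β = t + (k + k) by linarith]
  simp only [zsmul_eq_mul]
  push_cast
  ring

/-- A discriminant `t² - 4n` is `0` or `1` mod `4`. -/
theorem discr_le_neg_three (hneg : discr F < 0) : discr F ≤ -3 := by
  obtain ⟨t, n, -, -, -, hD⟩ := exists_quadratic_basis (F := F)
  rcases Int.even_or_odd' t with ⟨k, rfl | rfl⟩ <;> ring_nf at hD ⊢ <;> omega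

theorem sq_repr_unit_le_one (hneg : discr F < 0) {β γ : ℤ} {b : Module.Basis (Fin 2) ℤ (𝓞 F)}
    (h0 : b 0 = 1) (h1 : b 1 * b 1 = β • b 1 - γ • 1) (u : (𝓞 F)ˣ) : b.repr u 1 ^ 2 ≤ 1 := by
  have h := four_eq_of_unit hneg h0 h1 u
  have h3 := discr_le_neg_three hneg
  by_contra! hlt
  nlinarith [sq_nonneg (2 * b.repr u 0 + β * b.repr u 1)]

theorem finite_units (hneg : discr F < 0) : Finite (𝓞 F)ˣ := by
  obtain ⟨β, γ, b, h0, h1, hD⟩ := exists_quadratic_basis (F := F)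
  let S := Set.Icc (-(2 + |β|)) (2 + |β|) ×ˢ Set.Icc (-1 : ℤ) 1
  have hS : S.Finite := (Set.finite_Icc _ _).prod (Set.finite_Icc _ _)
  have hmem : ∀ u : (𝓞 F)ˣ, (b.repr u 0, b.repr u 1) ∈ S := by
    intro u
    have h := four_eq_of_unit hneg h0 h1 u
    have hy := abs_le_one_iff_mul_self_le_one.mpr
      ((sq _).symm.trans_le (sq_repr_unit_le_one hneg h0 h1 u))
    have hx : |2 * b.repr u 0 + β * b.repr u 1| ≤ 2 := by
      have := mul_nonneg (neg_nonneg.2 hneg.le) (sq_nonneg (b.repr u 1))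
      exact abs_le_of_sq_le_sq (by linarith) zero_le_two
    have hβ : |β * b.repr u 1| ≤ |β| := by
      rw [abs_mul]
      exact mul_le_of_le_one_right (abs_nonneg _) hy
    rw [abs_le] at hx hy hβ
    refine ⟨⟨?_, ?_⟩, ⟨hy.1, hy.2⟩⟩ <;> simp only <;> linarith [abs_nonneg β]
  have := hS.to_subtype
  refine Finite.of_injective (fun u : (𝓞 F)ˣ => (⟨_, hmem u⟩ : S)) fun u v h => Units.ext ?_
  have h := congrArg Subtype.val h
  simp only [Prod.mk.injEq] at h
  rw [eq_repr_quadratic b h0 (u : 𝓞 F), eq_repr_quadratic b h0 (v : 𝓞 F), h.1, h.2]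

theorem sq_repr_unit_eq_one (hneg : discr F < 0) {β γ : ℤ} {b : Module.Basis (Fin 2) ℤ (𝓞 F)}
    (h0 : b 0 = 1) (h1 : b 1 * b 1 = β • b 1 - γ • 1) {u : (𝓞 F)ˣ} (hu : u ≠ 1) (hu' : u ≠ -1) :
    b.repr u 1 ^ 2 = 1 := by
  have h := four_eq_of_unit hneg h0 h1 u
  have hle := sq_repr_unit_le_one hneg h0 h1 u
  by_contra hne
  have hy : b.repr u 1 = 0 := by
    have : b.repr u 1 ^ 2 = 0 := by
      have := sq_nonneg (b.repr u 1)
      omega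
    exact pow_eq_zero_iff two_ne_zero |>.mp this
  have hu2 := eq_repr_quadratic b h0 (u : 𝓞 F)
  rw [hy] at h hu2
  have hx : b.repr u 0 ^ 2 = 1 := by linarith
  rcases mul_self_eq_one_iff.mp ((sq _).symm.trans hx) with h | h
  · exact hu (Units.ext (by rw [hu2, h]; simp))
  · exact hu' (Units.ext (by rw [hu2, h]; simp))

/-- The coordinate of `u` along `b 1` is `±1`, so `b 1` is an integral combination of `1` and `u`.
-/
theorem adjoin_unit_eq_top (hneg : discr F < 0) {u : (𝓞 F)ˣ} (hu : u ≠ 1) (hu' : u ≠ -1) :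
    Algebra.adjoin ℤ {(u : 𝓞 F)} = ⊤ := by
  obtain ⟨β, γ, b, h0, h1, hD⟩ := exists_quadratic_basis (F := F)
  have hy := sq_repr_unit_eq_one hneg h0 h1 hu hu'
  set A := Algebra.adjoin ℤ {(u : 𝓞 F)}
  have hb : b 1 ∈ A := by
    have : b 1 = b.repr u 1 • ((u : 𝓞 F) - b.repr u 0 • 1) := by
      have h : (u : 𝓞 F) - b.repr u 0 • 1 = b.repr u 1 • b 1 :=
        sub_eq_of_eq_add' (eq_repr_quadratic b h0 (u : 𝓞 F))
      rw [h, smul_smul, ← sq, hy, one_smul]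
    rw [this]
    exact A.zsmul_mem (A.sub_mem (Algebra.self_mem_adjoin_singleton ℤ _) (A.zsmul_mem A.one_mem _)) _
  rw [eq_top_iff]
  intro z _
  rw [eq_repr_quadratic b h0 z]
  exact A.add_mem (A.zsmul_mem A.one_mem _) (A.zsmul_mem hb _)

theorem neg_four_le_discr (hneg : discr F < 0) {u : (𝓞 F)ˣ} (hu : u ≠ 1) (hu' : u ≠ -1) :
    -4 ≤ discr F := by
  obtain ⟨β, γ, b, h0, h1, hD⟩ := exists_quadratic_basis (F := F)
  have h := four_eq_of_unit hneg h0 h1 u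
  rw [sq_repr_unit_eq_one hneg h0 h1 hu hu'] at h
  nlinarith [sq_nonneg (2 * b.repr u 0 + β * b.repr u 1)]

theorem isPrincipalIdealRing_of_unit [IsTotallyComplex F] (hneg : discr F < 0) {u : (𝓞 F)ˣ}
    (hu : u ≠ 1) (hu' : u ≠ -1) : IsPrincipalIdealRing (𝓞 F) := by
  have h4 := neg_four_le_discr hneg hu hu'
  apply RingOfIntegers.isPrincipalIdealRing_of_abs_discr_lt
  have hr := IsTotallyComplex.finrank F
  have h2 : Module.finrank ℚ F = 2 := Algebra.IsQuadraticExtension.finrank_eq_two ℚ F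
  rw [h2] at hr ⊢
  have hr' : InfinitePlace.nrComplexPlaces F = 1 := by omega
  rw [hr', abs_of_neg hneg]
  have hlt : (-discr F : ℝ) ≤ 4 := by
    have : -discr F ≤ 4 := by linarith
    exact_mod_cast this
  push_cast
  simp only [Nat.factorial_two, pow_one]
  push_cast
  -- The Minkowski bound here is `|discr F| < π²`, and `4 < 9 < π²`.
  nlinarith [Real.pi_gt_three]

end QuadraticBasis

end BinaryLattice

namespace BinaryLattice

open NumberField
open scoped nonZeroDivisors Pointwise

/-! ### Proper isometries as multiplications by norm-one elements. -/

section Transfer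

/-- A linear automorphism of a quadratic algebra that has determinant one and preserves the norm
is the multiplication by an element of norm one. -/
theorem exists_eq_mul_of_norm_eq {F : Type*} [Field F] [Algebra ℚ F]
    (b : Module.Basis (Fin 2) ℚ F) (h0 : b 0 = 1) {β γ : ℚ} (h1 : b 1 * b 1 = β • b 1 - γ • 1)
    (τ : F →ₗ[ℚ] F) (hdet : LinearMap.det τ = 1)
    (hτ : ∀ x, Algebra.norm ℚ (τ x) = Algebra.norm ℚ x) :
    Algebra.norm ℚ (τ 1) = 1 ∧ ∀ x, τ x = τ 1 * x := by
  have hu : Algebra.norm ℚ (τ 1) = 1 := by rw [hτ, map_one]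
  have := Module.Finite.of_basis b
  have hu0 : τ 1 ≠ 0 := fun h => by simp [h] at hu
  set u := τ 1 with hu_def
  have hinv : Algebra.norm ℚ u⁻¹ = 1 := by
    have := map_mul (Algebra.norm ℚ) u⁻¹ u
    rwa [inv_mul_cancel₀ hu0, map_one, hu, mul_one, eq_comm] at this
  refine ⟨hu, fun x => ?_⟩
  -- Dividing by `τ 1` gives a norm-preserving map that fixes `1`; its determinant then forces `ρ (b
  -- 1) = p + b 1`.
  set ρ : F →ₗ[ℚ] F := Algebra.lmul ℚ F u⁻¹ ∘ₗ τ with hρ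
  have hρdet : LinearMap.det ρ = 1 := by
    rw [hρ, LinearMap.det_comp, hdet, mul_one]
    exact hinv
  have hρn : ∀ x, Algebra.norm ℚ (ρ x) = Algebra.norm ℚ x := fun x => by
    change Algebra.norm ℚ (u⁻¹ * τ x) = _
    rw [map_mul, hinv, one_mul, hτ]
  have hρ1 : ρ 1 = 1 := inv_mul_cancel₀ hu0
  obtain ⟨p, q, hpq⟩ : ∃ p q : ℚ, ρ (b 1) = p • 1 + q • b 1 :=
    ⟨_, _, by rw [← h0, ← Fin.sum_univ_two (fun i => b.repr (ρ (b 1)) i • b i), b.sum_repr]⟩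
  have hq : q = 1 := by
    rw [← hρdet, ← LinearMap.det_toMatrix b, Matrix.det_fin_two]
    simp only [LinearMap.toMatrix_apply, h0, hρ1, hpq]
    rw [← h0]
    simp
  subst hq
  -- The norms of `b 1` and `1 + b 1` give `p² + βp = 0` and `p² + 2p + βp = 0`, hence `p = 0`.
  have n1 := hρn (b 1)
  have n2 := hρn (1 + b 1)
  have n0 := norm_quadratic b h0 h1 0 1
  have n0' := norm_quadratic b h0 h1 1 1
  have n3 := norm_quadratic b h0 h1 p 1
  have n4 := norm_quadratic b h0 h1 (1 + p) 1
  rw [hpq, n3] at n1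
  rw [map_add, hpq, hρ1, ← add_assoc, ← one_smul ℚ (1 : F), smul_smul, mul_one, ← add_smul, n4] at n2
  simp only [zero_smul, zero_add, one_smul] at n0 n0' n2
  rw [n0] at n1
  rw [n0'] at n2
  have hp : p = 0 := by linarith
  have hρid : ρ = LinearMap.id := by
    refine b.ext fun i => ?_
    fin_cases i
    · simp [h0, hρ1]
    · simp [hpq, hp]
  have : u⁻¹ * τ x = x := LinearMap.congr_fun hρid x
  rw [← this, mul_inv_cancel_left₀ hu0, this]

variable {V : Type*} [AddCommGroup V] [Module ℚ V] {F : Type*} [Field F] [NumberField F]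

/-- The additive map from the ring of integers to `V` induced by an identification of `V` with the
field. -/
def integersToSpace (φ : V ≃ₗ[ℚ] F) : 𝓞 F →+ V :=
  φ.symm.toAddEquiv.toAddMonoidHom.comp (algebraMap (𝓞 F) F).toAddMonoidHom

theorem apply_integersToSpace (φ : V ≃ₗ[ℚ] F) (x : 𝓞 F) : φ (integersToSpace φ x) = x :=
  φ.apply_symm_apply x

theorem integersToSpace_injective (φ : V ≃ₗ[ℚ] F) : Function.Injective (integersToSpace φ) :=
  φ.symm.injective.comp RingOfIntegers.coe_injective

/-- Here `σ` is multiplication by `x / y`; clearing the denominator keeps the comparison inside `𝓞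
F`. -/
theorem image_eq_iff_smul_eq (φ : V ≃ₗ[ℚ] F) {σ : V ≃ₗ[ℚ] V} {x y : 𝓞 F} (hy : y ≠ 0)
    (h : ∀ v, (y : F) * φ (σ v) = x * φ v) (K K' : AddSubgroup (𝓞 F)) :
    (σ '' (K.map (integersToSpace φ) : Set V)) = (K'.map (integersToSpace φ) : Set V) ↔
      x • K = y • K' := by
  have hy' : (y : F) ≠ 0 := RingOfIntegers.coe_ne_zero_iff.mpr hy
  have hinj : Function.Injective fun v => (y : F) * φ v :=
    (mul_right_injective₀ hy').comp φ.injective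
  rw [← hinj.image_injective.eq_iff, ← SetLike.coe_set_eq (p := x • K),
    ← (RingOfIntegers.coe_injective (K := F)).image_injective.eq_iff,
    AddSubgroup.coe_pointwise_smul, AddSubgroup.coe_pointwise_smul, AddSubgroup.coe_map,
    AddSubgroup.coe_map, ← Set.image_smul, ← Set.image_smul]
  simp only [Set.image_image, h, apply_integersToSpace, smul_eq_mul, map_mul]

/-- The subgroups of index `m` of an ideal correspond to those of the corresponding lattice. -/
noncomputable def sublatticesEquiv (φ : V ≃ₗ[ℚ] F) {L : Submodule ℤ V} {I : Ideal (𝓞 F)}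
    (hL : L.toAddSubgroup = I.toAddSubgroup.map (integersToSpace φ)) (m : ℕ) :
    sublatticesOfIdeal I m ≃ sublatticesOfIndex L m where
  toFun K := ⟨AddSubgroup.toIntSubmodule (K.1.map (integersToSpace φ)), by
    change K.1.map (integersToSpace φ) ≤ L.toAddSubgroup
    rw [hL]
    exact AddSubgroup.map_mono K.2.1, by
    change (K.1.map (integersToSpace φ)).relIndex L.toAddSubgroup = m
    rw [hL, AddSubgroup.relIndex_map_map_of_injective _ _ (integersToSpace_injective φ), K.2.2]⟩
  invFun K := ⟨K.1.toAddSubgroup.comap (integersToSpace φ), by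
    have h : K.1.toAddSubgroup ≤ L.toAddSubgroup := K.2.1
    rw [hL] at h
    refine (AddSubgroup.comap_mono h).trans_eq ?_
    exact AddSubgroup.comap_map_eq_self_of_injective (integersToSpace_injective φ) _, by
    rw [AddSubgroup.relIndex_comap, ← hL, K.2.2]⟩
  left_inv K := Subtype.ext
    (AddSubgroup.comap_map_eq_self_of_injective (integersToSpace_injective φ) K.1)
  right_inv K := by
    refine Subtype.ext ?_
    have h : K.1.toAddSubgroup ≤ L.toAddSubgroup := K.2.1
    rw [hL] at h
    refine Submodule.toAddSubgroup_injective ?_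
    change (K.1.toAddSubgroup.comap (integersToSpace φ)).map (integersToSpace φ) = _
    exact AddSubgroup.map_comap_eq_self (h.trans (AddSubgroup.map_le_range _ _))

theorem exists_mem_properOrthogonalGroup {Q : QuadraticForm ℚ V} (φ : V ≃ₗ[ℚ] F) {c : ℚ}
    (hc : c ≠ 0) (hN : ∀ v, Algebra.norm ℚ (φ v) = c * Q v) {u : F} (hu : Algebra.norm ℚ u = 1) :
    ∃ σ ∈ properOrthogonalGroup Q, ∀ v, φ (σ v) = u * φ v := by
  have hu0 : u ≠ 0 := by rintro rfl; simp at hu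
  let μ : F ≃ₗ[ℚ] F := LinearEquiv.ofBijective (Algebra.lmul ℚ F u)
    ⟨mul_right_injective₀ hu0, fun x => ⟨u⁻¹ * x, mul_inv_cancel_left₀ hu0 x⟩⟩
  have hφ : ∀ v, φ ((φ ≪≫ₗ μ ≪≫ₗ φ.symm) v) = u * φ v := fun v => φ.apply_symm_apply _
  refine ⟨φ ≪≫ₗ μ ≪≫ₗ φ.symm, ⟨fun v => ?_, ?_⟩, hφ⟩
  · refine mul_left_cancel₀ hc ?_
    rw [← hN, ← hN, hφ, map_mul, hu, one_mul]
  · refine Units.ext ?_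
    rw [LinearEquiv.coe_det, Units.val_one, ← hu]
    exact LinearMap.det_conj (Algebra.lmul ℚ F u) φ.symm

/-- Equal indices force `|N(x)| = |N(y)|`, and positive definiteness removes the absolute values, so
`x / y` has norm one and gives a proper isometry. Conversely, a proper isometry is multiplication by
some fraction `x / y`. -/
theorem properClassCount_eq {Q : QuadraticForm ℚ V} (hQ : ∀ v : V, v ≠ 0 → 0 < Q v)
    (φ : V ≃ₗ[ℚ] F) {c : ℚ} (hc : 0 < c) (hN : ∀ v, Algebra.norm ℚ (φ v) = c * Q v)
    (b : Module.Basis (Fin 2) ℚ F) (h0 : b 0 = 1) {β γ : ℚ} (h1 : b 1 * b 1 = β • b 1 - γ • 1)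
    {L : Submodule ℤ V} {I : Ideal (𝓞 F)} (hI : I ≠ ⊥)
    (hL : L.toAddSubgroup = I.toAddSubgroup.map (integersToSpace φ)) {m : ℕ} (hm : m ≠ 0) :
    properClassCount Q L m = Nat.card (Quotient (scalingSetoid I m)) := by
  refine Nat.card_congr (Quotient.congr (sublatticesEquiv φ hL m) fun K K' => ?_).symm
  change (∃ x y : 𝓞 F, x ≠ 0 ∧ y ≠ 0 ∧ x • K.1 = y • K'.1) ↔
    ∃ σ ∈ properOrthogonalGroup Q, (σ '' (K.1.map (integersToSpace φ) : Set V)) =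
      (K'.1.map (integersToSpace φ) : Set V)
  constructor
  · rintro ⟨x, y, hx, hy, h⟩
    have hpos : ∀ z : 𝓞 F, z ≠ 0 → 0 < Algebra.norm ℚ (z : F) := fun z hz => by
      rw [← φ.apply_symm_apply (z : F), hN]
      refine mul_pos hc (hQ _ ?_)
      rw [Ne, LinearEquiv.map_eq_zero_iff]
      exact RingOfIntegers.coe_ne_zero_iff.mpr hz
    have hxy : Algebra.norm ℚ (x : F) = Algebra.norm ℚ (y : F) := by
      have := absNorm_eq_of_smul_eq hI hm K.2 K'.2 hx hy h
      rw [Ideal.absNorm_span_singleton, Ideal.absNorm_span_singleton] at this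
      rw [← abs_of_pos (hpos x hx), ← abs_of_pos (hpos y hy), ← Algebra.coe_norm_int,
        ← Algebra.coe_norm_int, ← Int.cast_abs, ← Int.cast_abs, Int.abs_eq_natAbs,
        Int.abs_eq_natAbs, this]
    have hy' : (y : F) ≠ 0 := RingOfIntegers.coe_ne_zero_iff.mpr hy
    obtain ⟨σ, hσ, hσφ⟩ := exists_mem_properOrthogonalGroup φ hc.ne' hN (u := (x : F) / y)
      (by
        refine mul_right_cancel₀ (hpos y hy).ne' ?_
        rw [← map_mul, div_mul_cancel₀ _ hy', hxy, one_mul])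
    refine ⟨σ, hσ, (image_eq_iff_smul_eq φ hy (fun v => ?_) _ _).mpr h⟩
    rw [hσφ, ← mul_assoc, mul_div_cancel₀ _ hy']
  · rintro ⟨σ, ⟨hσ, hdet⟩, h⟩
    let τ : F →ₗ[ℚ] F := φ.toLinearMap ∘ₗ σ.toLinearMap ∘ₗ φ.symm.toLinearMap
    have hτ : ∀ v, τ (φ v) = φ (σ v) := fun v => by simp [τ]
    obtain ⟨hu, huτ⟩ := exists_eq_mul_of_norm_eq b h0 h1 τ
      (by
        rw [LinearMap.det_conj, ← LinearEquiv.coe_det, hdet, Units.val_one])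
      (fun x => by
        obtain ⟨v, rfl⟩ := φ.surjective x
        rw [hτ, hN, hN, hσ])
    obtain ⟨x, y, hy, hxy⟩ := IsFractionRing.div_surjective (A := 𝓞 F) (τ 1)
    have hy0 := nonZeroDivisors.ne_zero hy
    have hy' : (y : F) ≠ 0 := RingOfIntegers.coe_ne_zero_iff.mpr hy0
    refine ⟨x, y, ?_, hy0, (image_eq_iff_smul_eq φ hy0 (fun v => ?_) _ _).mp h⟩
    · rintro rfl
      rw [← hxy] at hu
      simp at hu
    · rw [← hτ, huτ, ← hxy, ← mul_assoc]
      exact congrArg (· * φ v) (mul_div_cancel₀ _ hy')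

end Transfer

end BinaryLattice

namespace BinaryLattice

open NumberField
open scoped nonZeroDivisors Pointwise

/-! ### The lattice as an ideal of the ring of integers. -/

section Identification

variable {V : Type*} [AddCommGroup V] [Module ℚ V]

theorem quadraticForm_smul_add_smul (Q : QuadraticForm ℚ V) (x y : ℚ) (v w : V) :
    Q (x • v + y • w) = x ^ 2 * Q v + x * y * (Q (v + w) - Q v - Q w) + y ^ 2 * Q w := by
  have h : QuadraticMap.polar Q (x • v) (y • w) = x * y * QuadraticMap.polar Q v w := by
    rw [QuadraticMap.polar_smul_left, QuadraticMap.polar_smul_right, smul_eq_mul, smul_eq_mul,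
      mul_assoc]
  simp only [QuadraticMap.polar, QuadraticMap.map_smul, smul_eq_mul] at h
  linear_combination h

theorem neg_four_mul_det_gramMatrix (Q : QuadraticForm ℚ V) (e : Fin 2 → V) :
    -4 * (gramMatrix Q e).det =
      (Q (e 0 + e 1) - Q (e 0) - Q (e 1)) ^ 2 - 4 * (Q (e 0) * Q (e 1)) := by
  have h : ∀ v, Q (v + v) = 4 * Q v := fun v => by
    rw [← two_smul ℚ v, QuadraticMap.map_smul, smul_eq_mul]
    norm_num
  simp only [gramMatrix, Matrix.det_fin_two, Matrix.of_apply, h, add_comm (e 1) (e 0)]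
  ring

theorem det_gramMatrix_pos (Q : QuadraticForm ℚ V) (hQ : ∀ v : V, v ≠ 0 → 0 < Q v)
    (e : Module.Basis (Fin 2) ℚ V) : 0 < (gramMatrix Q e).det := by
  have h := neg_four_mul_det_gramMatrix Q e
  have h0 := hQ _ (e.ne_zero 0)
  set B := Q (e 0 + e 1) - Q (e 0) - Q (e 1) with hB
  -- This vector is orthogonal to `e 0`; its value under `Q` is `Q (e 0) * (4 Q (e 0) Q (e 1) -
  -- B²)`, which is `Q (e 0)` times four times the determinant.
  have hv : (-B) • e 0 + (2 * Q (e 0)) • e 1 ≠ 0 := by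
    intro h
    have := congrArg (fun v => e.repr v 1) h
    simp at this
    exact h0.ne' this
  have h1 := hQ _ hv
  rw [quadraticForm_smul_add_smul, ← hB] at h1
  have h2 : 0 < Q (e 0) * (4 * (gramMatrix Q e).det) := by linear_combination h1 + Q (e 0) * h
  linarith [(mul_pos_iff_of_pos_left h0).mp h2]

variable {F : Type*} [Field F] [NumberField F] [Algebra.IsQuadraticExtension ℚ F]

/-- The classical passage from forms to ideals: `N(Ax + ωy) = A (A x² + B x y + C y²)` when `ω` has
trace `B` and norm `AC`. -/
theorem exists_quadratic_identification (Q : QuadraticForm ℚ V) (hQ : ∀ v : V, v ≠ 0 → 0 < Q v)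
    (e : Module.Basis (Fin 2) ℚ V) (L : Submodule ℤ V) (hL : L = Submodule.span ℤ (Set.range e))
    (hint : ∀ x ∈ L, ∃ k : ℤ, Q x = k)
    (hdisc : (discr F : ℚ) = -4 * (gramMatrix Q e).det) :
    ∃ (φ : V ≃ₗ[ℚ] F) (I : Ideal (𝓞 F)) (b : Module.Basis (Fin 2) ℚ F) (β γ : ℚ),
      (∀ v, Algebra.norm ℚ (φ v) = Q (e 0) * Q v) ∧ b 0 = 1 ∧ b 1 * b 1 = β • b 1 - γ • 1 ∧
      I ≠ ⊥ ∧ L.toAddSubgroup = I.toAddSubgroup.map (integersToSpace φ) := by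
  have he : ∀ i, e i ∈ L := fun i => hL ▸ Submodule.subset_span ⟨i, rfl⟩
  obtain ⟨A, hA⟩ := hint _ (he 0)
  obtain ⟨C, hC⟩ := hint _ (he 1)
  obtain ⟨S, hS⟩ := hint _ (L.add_mem (he 0) (he 1))
  have hA0 : A ≠ 0 := by
    rintro rfl
    exact (hQ _ (e.ne_zero 0)).ne' (by simpa using hA)
  have hD : discr F = (S - A - C) ^ 2 - 4 * (A * C) := by
    have := hdisc.trans (neg_four_mul_det_gramMatrix Q e)
    rw [hA, hC, hS] at this
    exact_mod_cast this
  obtain ⟨b, h0, h1⟩ := exists_quadratic_basis_of_eq_discr hD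
  set B := S - A - C with hB
  let b' : Module.Basis (Fin 2) ℚ F := b.localizationLocalization ℚ ℤ⁰ F
  have hb' : ∀ i, b' i = b i := fun i => Module.Basis.localizationLocalization_apply ..
  have h0' : b' 0 = 1 := by
    rw [hb', h0]
    rfl
  have h1' : b' 1 * b' 1 = (B : ℚ) • b' 1 - ((A * C : ℤ) : ℚ) • 1 := by
    have := congrArg (algebraMap (𝓞 F) F) h1
    simp only [map_mul, map_sub, zsmul_eq_mul, map_intCast, mul_one] at this
    rw [hb', Algebra.smul_def, Algebra.smul_def, mul_one, map_intCast, map_intCast]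
    exact this
  let w : Module.Basis (Fin 2) ℚ F := b'.isUnitSMul (w := ![(A : ℚ), 1])
    (fun i => by fin_cases i <;> simp [hA0])
  let φ : V ≃ₗ[ℚ] F := e.equiv w (Equiv.refl _)
  have hφ0 : φ (e 0) = (A : F) := by
    simp [φ, w, Module.Basis.isUnitSMul_apply, h0', Algebra.smul_def]
  have hφ1 : φ (e 1) = b 1 := by
    simp [φ, w, Module.Basis.isUnitSMul_apply, hb']
  have hv : ∀ v, v = e.repr v 0 • e 0 + e.repr v 1 • e 1 := fun v => by
    rw [← Fin.sum_univ_two (fun i => e.repr v i • e i), e.sum_repr]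
  -- This relation makes `ℤA + ℤω` stable under `ω`, hence an ideal.
  have hω : (B - b 1) * b 1 = (A * C : 𝓞 F) := by
    rw [sub_mul, h1, zsmul_eq_mul, zsmul_eq_mul]
    push_cast
    ring
  let I : Ideal (𝓞 F) := Ideal.span {(A : 𝓞 F), b 1}
  have hI : ∀ x : 𝓞 F, x ∈ I ↔ ∃ p q : ℤ, x = p * A + q * b 1 := by
    intro x
    rw [Ideal.mem_span_pair]
    constructor
    · rintro ⟨r, s, rfl⟩
      rw [eq_repr_quadratic b h0 r, eq_repr_quadratic b h0 s]
      generalize b.repr r 0 = r0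
      generalize b.repr r 1 = r1
      generalize b.repr s 0 = s0
      generalize b.repr s 1 = s1
      refine ⟨r0 - s1 * C, r1 * A + s0 + s1 * B, ?_⟩
      simp only [zsmul_eq_mul]
      push_cast
      linear_combination (-s1 : 𝓞 F) * hω
    · rintro ⟨p, q, rfl⟩
      exact ⟨p, q, rfl⟩
  refine ⟨φ, I, b', B, (A * C : ℤ), fun v => ?_, h0', h1', fun h => ?_, ?_⟩
  · conv_lhs => rw [hv v]
    conv_rhs => rw [hv v, quadraticForm_smul_add_smul]
    have hA1 : (A : F) = (A : ℚ) • 1 := by rw [Algebra.smul_def, map_intCast, mul_one]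
    rw [map_add, map_smul, map_smul, hφ0, hφ1, ← hb', hA1, smul_smul, norm_quadratic b' h0' h1',
      hA, hC, hS, hB]
    push_cast
    ring
  · have : (A : 𝓞 F) ∈ I := Ideal.subset_span (by simp)
    rw [h, Ideal.mem_bot] at this
    exact hA0 (by exact_mod_cast this)
  · have hg : ∀ p q : ℤ, integersToSpace φ (p * A + q * b 1) = p • e 0 + q • e 1 := fun p q =>
      φ.injective (by
        rw [apply_integersToSpace, map_add, map_zsmul, map_zsmul, hφ0, hφ1]
        simp)
    have hrange : Set.range e = {e 0, e 1} := by
      ext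
      simp [Fin.exists_fin_two, eq_comm]
    ext v
    rw [Submodule.mem_toAddSubgroup, hL, hrange, Submodule.mem_span_pair, AddSubgroup.mem_map]
    constructor
    · rintro ⟨p, q, rfl⟩
      exact ⟨_, (hI _).mpr ⟨p, q, rfl⟩, hg p q⟩
    · rintro ⟨x, hx, rfl⟩
      obtain ⟨p, q, rfl⟩ := (hI x).mp hx
      exact ⟨p, q, (hg p q).symm⟩

end Identification

end BinaryLattice

namespace BinaryLattice

open NumberField
open scoped nonZeroDivisors

/-! ### Counting ideals by norm and comparing with split primes. -/

section IdealCount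

variable (F : Type*) [Field F]

open scoped Classical in
/-- The indicator function of the positive integers all of whose prime factors are split. -/
noncomputable def splitIndicator : ArithmeticFunction ℕ :=
  ⟨fun n => if n ≠ 0 ∧ ∀ p ∈ n.primeFactors, p ∈ splitPrimes F then 1 else 0, by simp⟩

variable {F}

open scoped Classical in
theorem splitIndicator_apply (n : ℕ) : splitIndicator F n =
    if n ≠ 0 ∧ ∀ p ∈ n.primeFactors, p ∈ splitPrimes F then 1 else 0 := rfl

theorem splitIndicator_mul (m n : ℕ) :
    splitIndicator F (m * n) = splitIndicator F m * splitIndicator F n := by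
  classical
  rcases eq_or_ne m 0 with rfl | hm
  · simp
  rcases eq_or_ne n 0 with rfl | hn
  · simp
  simp only [splitIndicator_apply, Nat.primeFactors_mul hm hn, Finset.mem_union, or_imp,
    forall_and, hm, hn, mul_ne_zero_iff, ne_eq, not_false_eq_true, true_and]
  split_ifs <;> simp_all

theorem splitIndicator_one : splitIndicator F 1 = 1 := by simp [splitIndicator_apply]

theorem isMultiplicative_splitIndicator : (splitIndicator F).IsMultiplicative :=
  ⟨splitIndicator_one, fun _ => splitIndicator_mul _ _⟩

theorem splitIndicator_prime_pow {p k : ℕ} (hp : p.Prime) (hk : k ≠ 0)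
    [Decidable (p ∈ splitPrimes F)] :
    splitIndicator F (p ^ k) = if p ∈ splitPrimes F then 1 else 0 := by
  simp [splitIndicator_apply, Nat.primeFactors_prime_pow hk hp, hp.ne_zero]

theorem mem_primesOver_iff {p : ℕ} (hp : p.Prime) {P : Ideal (𝓞 F)} :
    P ∈ (Ideal.span {(p : ℤ)}).primesOver (𝓞 F) ↔ P.IsPrime ∧ (p : 𝓞 F) ∈ P := by
  refine and_congr_right fun hP => ?_
  have hmax : (Ideal.span {(p : ℤ)}).IsMaximal :=
    PrincipalIdealRing.isMaximal_of_irreducible (Nat.prime_iff_prime_int.mp hp).irreducible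
  rw [Ideal.liesOver_iff]
  constructor
  · intro h
    have : (p : ℤ) ∈ P.under ℤ := h ▸ Ideal.mem_span_singleton_self _
    simpa [Ideal.mem_comap] using this
  · intro h
    refine hmax.eq_of_le (hP.under ℤ).ne_top ?_
    rw [Ideal.span_singleton_le_iff_mem]
    simpa [Ideal.mem_comap] using h

variable (F) [NumberField F]

/-- The number of ideals of norm `n ≥ 1`, as an arithmetic function. -/
noncomputable def idealCount : ArithmeticFunction ℕ :=
  ⟨fun n => if n = 0 then 0 else Nat.card {I : Ideal (𝓞 F) // Ideal.absNorm I = n}, if_pos rfl⟩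

/-- The indicator function of the norms of nonzero ideals. -/
noncomputable def normIndicator : ArithmeticFunction ℕ :=
  ⟨fun n => if idealCount F n = 0 then 0 else 1, by simp⟩

variable {F}

theorem idealCount_apply {n : ℕ} (hn : n ≠ 0) :
    idealCount F n = Nat.card {I : Ideal (𝓞 F) // Ideal.absNorm I = n} := if_neg hn

theorem idealCount_one : idealCount F 1 = 1 := by
  rw [idealCount_apply one_ne_zero, Nat.card_eq_one_iff_unique]
  exact ⟨⟨fun I J => Subtype.ext ((Ideal.absNorm_eq_one_iff.mp I.2).trans
    (Ideal.absNorm_eq_one_iff.mp J.2).symm)⟩, ⟨⊤, Ideal.absNorm_top⟩⟩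

theorem sup_span_natCast_of_mul {m n : ℕ} (h : m.Coprime n) {I J : Ideal (𝓞 F)}
    (hI : Ideal.absNorm I = m) (hJ : Ideal.absNorm J = n) :
    I * J ⊔ Ideal.span {(m : 𝓞 F)} = I := by
  have hmI : (m : 𝓞 F) ∈ I := hI ▸ Ideal.absNorm_mem I
  have hnJ : (n : 𝓞 F) ∈ J := hJ ▸ Ideal.absNorm_mem J
  refine le_antisymm (sup_le Ideal.mul_le_left ((Ideal.span_singleton_le_iff_mem _).mpr hmI))
    fun x hx => ?_
  obtain ⟨u, v, huv⟩ := (Nat.isCoprime_iff_coprime.mpr h)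
  have huv' : (u * m + v * n : 𝓞 F) = 1 := by exact_mod_cast congrArg (Int.cast : ℤ → 𝓞 F) huv
  rw [← mul_one x, ← huv', mul_add, add_comm]
  refine Submodule.add_mem_sup ?_ ?_
  · exact Ideal.mul_mem_mul hx (J.mul_mem_left _ hnJ)
  · rw [← mul_assoc]
    exact Ideal.mul_mem_left _ _ (Ideal.mem_span_singleton_self _)

/-- An ideal of norm `m * n` splits into its `m`-part and `n`-part by a Bézout relation; this is
what makes `idealCount` multiplicative. -/
theorem sup_mul_sup_eq {m n : ℕ} (h : m.Coprime n) {A : Ideal (𝓞 F)}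
    (hA : Ideal.absNorm A = m * n) :
    (A ⊔ Ideal.span {(m : 𝓞 F)}) * (A ⊔ Ideal.span {(n : 𝓞 F)}) = A := by
  have hmem : (m * n : 𝓞 F) ∈ A := by
    have := Ideal.absNorm_mem A
    rwa [hA, Nat.cast_mul] at this
  refine le_antisymm ?_ fun x hx => ?_
  · rw [Ideal.sup_mul, Ideal.mul_sup, Ideal.mul_sup]
    refine sup_le (sup_le Ideal.mul_le_left Ideal.mul_le_left) (sup_le Ideal.mul_le_right ?_)
    rwa [Ideal.span_singleton_mul_span_singleton, Ideal.span_singleton_le_iff_mem]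
  · obtain ⟨u, v, huv⟩ := (Nat.isCoprime_iff_coprime.mpr h)
    have huv' : (u * m + v * n : 𝓞 F) = 1 := by exact_mod_cast congrArg (Int.cast : ℤ → 𝓞 F) huv
    have hm : (u * m : 𝓞 F) ∈ A ⊔ Ideal.span {(m : 𝓞 F)} :=
      Ideal.mem_sup_right (Ideal.mul_mem_left _ _ (Ideal.mem_span_singleton_self _))
    have hn : (v * n : 𝓞 F) ∈ A ⊔ Ideal.span {(n : 𝓞 F)} :=
      Ideal.mem_sup_right (Ideal.mul_mem_left _ _ (Ideal.mem_span_singleton_self _))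
    rw [← mul_one x, ← huv', mul_add, mul_comm x]
    exact add_mem (Ideal.mul_mem_mul hm (Ideal.mem_sup_left hx))
      (Ideal.mul_mem_mul (Ideal.mem_sup_left hx) hn)

/-- The norm divides both a power of `m` and `m * n`, hence `m`. The same holds for `n`, and the
product of the two norms is `m * n`, so neither is smaller. -/
theorem absNorm_sup_span_natCast {m n : ℕ} (h : m.Coprime n) (hm : m ≠ 0) (hn : n ≠ 0)
    {A : Ideal (𝓞 F)} (hA : Ideal.absNorm A = m * n) :
    Ideal.absNorm (A ⊔ Ideal.span {(m : 𝓞 F)}) = m := by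
  have hdvd : ∀ {m n : ℕ}, m.Coprime n → Ideal.absNorm A = m * n →
      Ideal.absNorm (A ⊔ Ideal.span {(m : 𝓞 F)}) ∣ m := fun {m n} h hA => by
    have h1 : Ideal.absNorm (A ⊔ Ideal.span {(m : 𝓞 F)}) ∣ m ^ Module.finrank ℤ (𝓞 F) := by
      rw [← Ideal.absNorm_span_natCast]
      exact Ideal.absNorm_dvd_absNorm_of_le le_sup_right
    have h2 : Ideal.absNorm (A ⊔ Ideal.span {(m : 𝓞 F)}) ∣ m * n := by
      rw [← hA]
      exact Ideal.absNorm_dvd_absNorm_of_le le_sup_left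
    exact (Nat.Coprime.of_dvd_left h1 (h.pow_left _)).dvd_of_dvd_mul_right h2
  have hprod := congrArg Ideal.absNorm (sup_mul_sup_eq h hA)
  rw [map_mul, hA] at hprod
  obtain ⟨a, ha⟩ := hdvd h hA
  obtain ⟨b, hb⟩ := hdvd h.symm (hA.trans (mul_comm _ _))
  have : a = 1 := by
    refine Nat.eq_one_of_mul_eq_one_right (m := a) (n := b) (Nat.eq_of_mul_eq_mul_left
      (Nat.pos_of_ne_zero (hprod.trans_ne (mul_ne_zero hm hn))) ?_)
    rw [mul_mul_mul_comm, ← ha, ← hb, mul_one, hprod]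
  rw [this, mul_one] at ha
  exact ha.symm

theorem isMultiplicative_idealCount : (idealCount F).IsMultiplicative := by
  rw [ArithmeticFunction.IsMultiplicative.iff_ne_zero]
  refine ⟨idealCount_one, fun {m n} hm hn h => ?_⟩
  rw [idealCount_apply hm, idealCount_apply hn, idealCount_apply (mul_ne_zero hm hn),
    ← Nat.card_prod]
  refine Nat.card_congr ⟨fun A => ⟨⟨_, absNorm_sup_span_natCast h hm hn A.2⟩,
    ⟨_, absNorm_sup_span_natCast h.symm hn hm (A.2.trans (mul_comm _ _))⟩⟩,
    fun p => ⟨p.1 * p.2, by rw [map_mul, p.1.2, p.2.2]⟩, fun A => ?_, fun p => ?_⟩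
  · exact Subtype.ext (sup_mul_sup_eq h A.2)
  · refine Prod.ext (Subtype.ext (sup_span_natCast_of_mul h p.1.2 p.2.2)) (Subtype.ext ?_)
    simp only
    rw [mul_comm]
    exact sup_span_natCast_of_mul h.symm p.2.2 p.1.2

theorem normIndicator_apply (n : ℕ) :
    normIndicator F n = if idealCount F n = 0 then 0 else 1 := rfl

theorem isMultiplicative_normIndicator : (normIndicator F).IsMultiplicative := by
  refine ⟨by simp [normIndicator_apply, idealCount_one], fun {m n} h => ?_⟩
  simp only [normIndicator_apply, isMultiplicative_idealCount.2 h, mul_eq_zero]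
  split_ifs <;> simp_all

theorem isMaximal_of_mem_primesOver {p : ℕ} (hp : p.Prime) {P : Ideal (𝓞 F)}
    (hP : P ∈ (Ideal.span {(p : ℤ)}).primesOver (𝓞 F)) : P.IsMaximal := by
  obtain ⟨h1, h2⟩ := (mem_primesOver_iff hp).mp hP
  refine h1.isMaximal ?_
  rintro rfl
  exact hp.ne_zero (by exact_mod_cast (Ideal.mem_bot.mp h2))

theorem isCoprime_of_mem_primesOver {p : ℕ} (hp : p.Prime) {P P' : Ideal (𝓞 F)}
    (hP : P ∈ (Ideal.span {(p : ℤ)}).primesOver (𝓞 F))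
    (hP' : P' ∈ (Ideal.span {(p : ℤ)}).primesOver (𝓞 F)) (hne : P ≠ P') : IsCoprime P P' :=
  have := isMaximal_of_mem_primesOver hp hP
  have := isMaximal_of_mem_primesOver hp hP'
  Ideal.isCoprime_of_isMaximal hne

theorem dvd_span_natCast_of_mem_primesOver {p : ℕ} (hp : p.Prime) {P : Ideal (𝓞 F)}
    (hP : P ∈ (Ideal.span {(p : ℤ)}).primesOver (𝓞 F)) : P ∣ Ideal.span {(p : 𝓞 F)} :=
  Ideal.dvd_iff_le.mpr ((Ideal.span_singleton_le_iff_mem _).mpr ((mem_primesOver_iff hp).mp hP).2)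

theorem exists_eq_mul_of_absNorm_eq_prime_pow {p k : ℕ} (hp : p.Prime) {I : Ideal (𝓞 F)}
    (hI : Ideal.absNorm I = p ^ k) (hk : k ≠ 0) :
    ∃ P ∈ (Ideal.span {(p : ℤ)}).primesOver (𝓞 F), ∃ J, I = P * J := by
  have hne : I ≠ ⊤ := fun h => by
    rw [h, Ideal.absNorm_top] at hI
    exact (Nat.one_lt_pow hk hp.one_lt).ne hI
  obtain ⟨P, hP, hle⟩ := I.exists_le_maximal hne
  refine ⟨P, (mem_primesOver_iff hp).mpr ⟨hP.isPrime, ?_⟩, Ideal.dvd_iff_le.mpr hle⟩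
  have := hle (Ideal.absNorm_mem I)
  rw [hI, Nat.cast_pow] at this
  exact hP.isPrime.mem_of_pow_mem _ this

theorem classCountOfNorm_eq_normIndicator [IsPrincipalIdealRing (𝓞 F)] {n : ℕ} (hn : n ≠ 0) :
    classCountOfNorm F n = normIndicator F n := by
  rw [normIndicator_apply, idealCount_apply hn, classCountOfNorm]
  have : Subsingleton (ClassGroup (𝓞 F)) := inferInstance
  split_ifs with h
  · rw [Set.ncard_eq_zero]
    refine Set.eq_empty_of_forall_notMem ?_
    rintro c ⟨J, hJ, -⟩
    have := (Nat.card_eq_zero.mp h).resolve_right (not_infinite_iff_finite.mpr inferInstance)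
    exact this.false ⟨J, hJ⟩
  · obtain ⟨⟨I, hI⟩⟩ := (Nat.card_ne_zero.mp h).1
    have hI0 : I ∈ (Ideal (𝓞 F))⁰ := mem_nonZeroDivisors_of_ne_zero (by
      rintro rfl
      simp [hn.symm] at hI)
    rw [Set.ncard_eq_one]
    exact ⟨ClassGroup.mk0 ⟨I, hI0⟩, Set.eq_singleton_iff_unique_mem.mpr
      ⟨⟨⟨I, hI0⟩, hI, rfl⟩, fun _ _ => Subsingleton.elim _ _⟩⟩

variable [Algebra.IsQuadraticExtension ℚ F]

theorem dvd_absNorm_of_mem_primesOver {p : ℕ} (hp : p.Prime) {P : Ideal (𝓞 F)}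
    (hP : P ∈ (Ideal.span {(p : ℤ)}).primesOver (𝓞 F)) : p ∣ Ideal.absNorm P := by
  obtain ⟨h1, h2⟩ := (mem_primesOver_iff hp).mp hP
  have hdvd : Ideal.absNorm P ∣ p ^ 2 := by
    rw [← finrank_int_ringOfIntegers_eq_two (F := F), ← Ideal.absNorm_span_natCast]
    exact Ideal.absNorm_dvd_absNorm_of_le ((Ideal.span_singleton_le_iff_mem _).mpr h2)
  obtain ⟨j, -, hj⟩ := (Nat.dvd_prime_pow hp).mp hdvd
  rw [hj]
  refine dvd_pow_self p fun h0 => h1.ne_top ?_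
  rw [← Ideal.absNorm_eq_one_iff, hj, h0, pow_zero]

/-- The product `P * P'` divides `(p)`, of norm `p²`, and each factor contributes at least one `p`.
A third prime would require `p³ ∣ p²`. -/
theorem absNorm_eq_of_ne_mem_primesOver {p : ℕ} (hp : p.Prime) {P P' : Ideal (𝓞 F)}
    (hP : P ∈ (Ideal.span {(p : ℤ)}).primesOver (𝓞 F))
    (hP' : P' ∈ (Ideal.span {(p : ℤ)}).primesOver (𝓞 F)) (hne : P ≠ P') :
    Ideal.absNorm P = p := by
  have h1 : P * P' ∣ Ideal.span {(p : 𝓞 F)} := (isCoprime_of_mem_primesOver hp hP hP' hne).mul_dvd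
    (dvd_span_natCast_of_mem_primesOver hp hP) (dvd_span_natCast_of_mem_primesOver hp hP')
  have h2 := map_dvd Ideal.absNorm h1
  rw [map_mul, Ideal.absNorm_span_natCast, finrank_int_ringOfIntegers_eq_two, sq] at h2
  refine Nat.dvd_antisymm ?_ (dvd_absNorm_of_mem_primesOver hp hP)
  refine Nat.dvd_of_mul_dvd_mul_right hp.pos ((Nat.mul_dvd_mul_left _ ?_).trans h2)
  exact dvd_absNorm_of_mem_primesOver hp hP'

theorem primesOver_eq_pair {p : ℕ} (hp : p.Prime) {P P' : Ideal (𝓞 F)}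
    (hP : P ∈ (Ideal.span {(p : ℤ)}).primesOver (𝓞 F))
    (hP' : P' ∈ (Ideal.span {(p : ℤ)}).primesOver (𝓞 F)) (hne : P ≠ P') :
    (Ideal.span {(p : ℤ)}).primesOver (𝓞 F) = {P, P'} := by
  refine Set.Subset.antisymm (fun P'' hP'' => ?_) (Set.pair_subset hP hP')
  by_contra h
  simp only [Set.mem_insert_iff, Set.mem_singleton_iff, not_or] at h
  have h1 : P'' * (P * P') ∣ Ideal.span {(p : 𝓞 F)} := by
    refine IsCoprime.mul_dvd ?_ (dvd_span_natCast_of_mem_primesOver hp hP'')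
      ((isCoprime_of_mem_primesOver hp hP hP' hne).mul_dvd
        (dvd_span_natCast_of_mem_primesOver hp hP) (dvd_span_natCast_of_mem_primesOver hp hP'))
    exact (isCoprime_of_mem_primesOver hp hP'' hP h.1).mul_right
      (isCoprime_of_mem_primesOver hp hP'' hP' h.2)
  have h2 := map_dvd Ideal.absNorm h1
  rw [map_mul, map_mul, Ideal.absNorm_span_natCast, finrank_int_ringOfIntegers_eq_two,
    absNorm_eq_of_ne_mem_primesOver hp hP hP' hne,
    absNorm_eq_of_ne_mem_primesOver hp hP' hP hne.symm,
    absNorm_eq_of_ne_mem_primesOver hp hP'' hP h.1, ← sq, ← pow_succ',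
    Nat.pow_dvd_pow_iff_le_right hp.one_lt] at h2
  omega

/-- With only one prime above `p`, an ideal of `p`-power norm is a power of it, determined by its
norm. -/
theorem idealCount_prime_pow_le_one {p : ℕ} (hp : p.Prime) (hsplit : p ∉ splitPrimes F) (k : ℕ) :
    idealCount F (p ^ k) ≤ 1 := by
  have huniq : ∀ P ∈ (Ideal.span {(p : ℤ)}).primesOver (𝓞 F),
      ∀ P' ∈ (Ideal.span {(p : ℤ)}).primesOver (𝓞 F), P = P' := by
    intro P hP P' hP'
    by_contra hne
    exact hsplit ⟨hp, by rw [primesOver_eq_pair hp hP hP' hne, Set.ncard_pair hne]⟩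
  have key : ∀ k, ∀ I J : Ideal (𝓞 F), Ideal.absNorm I = p ^ k → Ideal.absNorm J = p ^ k →
      I = J := by
    intro k
    induction k using Nat.strong_induction_on with
    | _ k ih =>
      intro I J hI hJ
      rcases eq_or_ne k 0 with rfl | hk
      · rw [Ideal.absNorm_eq_one_iff.mp hI, Ideal.absNorm_eq_one_iff.mp hJ]
      obtain ⟨P, hP, I', rfl⟩ := exists_eq_mul_of_absNorm_eq_prime_pow hp hI hk
      obtain ⟨P', hP', J', rfl⟩ := exists_eq_mul_of_absNorm_eq_prime_pow hp hJ hk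
      obtain rfl := huniq P hP P' hP'
      rw [map_mul] at hI hJ
      have hN : Ideal.absNorm P ≠ 0 := left_ne_zero_of_mul (hI.trans_ne (pow_pos hp.pos k).ne')
      obtain ⟨j, hj, hj'⟩ := (Nat.dvd_prime_pow hp).mp (Dvd.intro_left _ hI)
      have hIJ : Ideal.absNorm I' = Ideal.absNorm J' :=
        mul_left_cancel₀ hN (hI.trans hJ.symm)
      rw [ih j (lt_of_le_of_ne hj ?_) I' J' hj' (hIJ ▸ hj')]
      rintro rfl
      rw [hj'] at hI
      have h1 : Ideal.absNorm P = 1 :=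
        mul_right_cancel₀ (pow_pos hp.pos j).ne' (hI.trans (one_mul _).symm)
      have := dvd_absNorm_of_mem_primesOver hp hP
      rw [h1] at this
      exact hp.one_lt.ne' (Nat.dvd_one.mp this)
  rw [idealCount_apply (pow_pos hp.pos k).ne', Finite.card_le_one_iff_subsingleton]
  exact ⟨fun I J => Subtype.ext (key k I J I.2 J.2)⟩

/-- Both primes have norm `p`, so the ideals are `P ^ a * P' ^ b` with `a + b = k`. -/
theorem idealCount_prime_pow_of_split {p : ℕ} (hsplit : p ∈ splitPrimes F) (k : ℕ) :
    idealCount F (p ^ k) = k + 1 := by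
  obtain ⟨hp, hcard⟩ := hsplit
  obtain ⟨P, P', hne, hPP'⟩ := Set.ncard_eq_two.mp hcard
  have hP : P ∈ (Ideal.span {(p : ℤ)}).primesOver (𝓞 F) := hPP' ▸ Set.mem_insert _ _
  have hP' : P' ∈ (Ideal.span {(p : ℤ)}).primesOver (𝓞 F) := hPP' ▸ Set.mem_insert_of_mem _ rfl
  have hN := absNorm_eq_of_ne_mem_primesOver hp hP hP' hne
  have hN' := absNorm_eq_of_ne_mem_primesOver hp hP' hP hne.symm
  have key : ∀ k, ∀ I : Ideal (𝓞 F), Ideal.absNorm I = p ^ k → ∃ a b, I = P ^ a * P' ^ b := by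
    intro k
    induction k with
    | zero => exact fun I hI => ⟨0, 0, by simpa using Ideal.absNorm_eq_one_iff.mp hI⟩
    | succ k ih =>
      intro I hI
      obtain ⟨P'', hP'', J, rfl⟩ := exists_eq_mul_of_absNorm_eq_prime_pow hp hI k.succ_ne_zero
      have hJ : Ideal.absNorm P'' = p → Ideal.absNorm J = p ^ k := fun h => by
        rw [map_mul, h, pow_succ'] at hI
        exact Nat.eq_of_mul_eq_mul_left hp.pos hI
      rw [hPP'] at hP''
      rcases hP'' with rfl | rfl
      · obtain ⟨a, b, rfl⟩ := ih J (hJ hN)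
        exact ⟨a + 1, b, by ring⟩
      · obtain ⟨a, b, rfl⟩ := ih J (hJ hN')
        exact ⟨a, b + 1, by ring⟩
  have hP0 : P ≠ 0 := by rintro rfl; simp [hp.ne_zero.symm] at hN
  have hP0' : P' ≠ 0 := by rintro rfl; simp [hp.ne_zero.symm] at hN'
  have hinj : ∀ a b : ℕ, a < b → b ≤ k → P ^ a * P' ^ (k - a) ≠ P ^ b * P' ^ (k - b) := by
    intro a b hab hbk h
    rw [show b = a + (b - a) by omega, show k - a = (k - b) + (b - a) by omega, pow_add, pow_add,
      show k - (a + (b - a)) = k - b by omega, ← mul_assoc,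
      mul_right_comm _ (P ^ (b - a))] at h
    have h' := mul_left_cancel₀ (mul_ne_zero (pow_ne_zero a hP0) (pow_ne_zero (k - b) hP0')) h
    have hco := (isCoprime_of_mem_primesOver hp hP hP' hne).pow (m := b - a) (n := b - a)
    rw [h', isCoprime_self, Ideal.isUnit_iff] at hco
    have := congrArg Ideal.absNorm hco
    rw [map_pow, hN, Ideal.absNorm_top] at this
    exact (Nat.one_lt_pow (by omega) hp.one_lt).ne' this
  let f : Fin (k + 1) → {I : Ideal (𝓞 F) // Ideal.absNorm I = p ^ k} := fun a =>
    ⟨P ^ (a : ℕ) * P' ^ (k - a), by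
      rw [map_mul, map_pow, map_pow, hN, hN', ← pow_add, Nat.add_sub_cancel' a.is_le]⟩
  have hf : Function.Bijective f := by
    constructor
    · intro a b h
      have h' := congrArg Subtype.val h
      rcases lt_trichotomy a b with hab | hab | hab
      · exact absurd h' (hinj a b hab b.is_le)
      · exact hab
      · exact absurd h'.symm (hinj b a hab a.is_le)
    · rintro ⟨I, hI⟩
      obtain ⟨a, b, rfl⟩ := key k I hI
      have hab : a + b = k := by
        rw [map_mul, map_pow, map_pow, hN, hN', ← pow_add] at hI
        exact Nat.pow_right_injective hp.two_le hI
      refine ⟨⟨a, by omega⟩, Subtype.ext ?_⟩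
      change P ^ a * P' ^ (k - a) = _
      rw [show k - a = b by omega]
  rw [idealCount_apply (pow_pos hp.pos k).ne', ← Nat.card_congr (Equiv.ofBijective f hf),
    Nat.card_eq_fintype_card, Fintype.card_fin]

/-- Both sides are multiplicative. At `p ^ k` with `p` split, the convolution has `k + 1` terms
equal to one; otherwise only one term survives and `idealCount` is `0` or `1`. -/
theorem idealCount_eq_normIndicator_mul_splitIndicator :
    idealCount F = normIndicator F * splitIndicator F := by
  classical
  rw [isMultiplicative_idealCount.eq_iff_eq_on_prime_powers _ _
    (isMultiplicative_normIndicator.mul isMultiplicative_splitIndicator)]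
  intro p k hp
  rw [ArithmeticFunction.mul_apply,
    Nat.sum_divisorsAntidiagonal (fun a b => normIndicator F a * splitIndicator F b),
    Nat.sum_divisors_prime_pow hp]
  by_cases hsplit : p ∈ splitPrimes F
  · rw [idealCount_prime_pow_of_split hsplit, Finset.sum_congr rfl (g := fun _ => 1)]
    · simp
    · intro j hj
      rw [Nat.pow_div (Finset.mem_range_succ_iff.mp hj) hp.pos, normIndicator_apply,
        idealCount_prime_pow_of_split hsplit, if_neg (Nat.succ_ne_zero j), one_mul]
      rcases eq_or_ne (k - j) 0 with h | h
      · rw [h, pow_zero, splitIndicator_one]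
      · rw [splitIndicator_prime_pow hp h, if_pos hsplit]
  · rw [Finset.sum_range_succ, Finset.sum_eq_zero, zero_add, Nat.div_self (pow_pos hp.pos k),
      splitIndicator_one, mul_one, normIndicator_apply]
    · have := idealCount_prime_pow_le_one hp hsplit k
      split_ifs <;> omega
    · intro j hj
      have hj' := Finset.mem_range.mp hj
      rw [Nat.pow_div hj'.le hp.pos, splitIndicator_prime_pow hp (by omega), if_neg hsplit,
        mul_zero]

end IdealCount

end BinaryLattice

namespace BinaryLattice

open ArithmeticFunction ArithmeticFunction.sigma NumberField
open scoped nonZeroDivisors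

/-! ### Dirichlet series, convergence and the Euler product over split primes. -/

section Series

/-- The `L`-series of a Dirichlet convolution is the product of the `L`-series. -/
theorem LSeries_eq_mul_of_sum_divisorsAntidiagonal {f g h : ℕ → ℂ} {s : ℂ}
    (hf : LSeriesSummable f s) (hg : LSeriesSummable g s)
    (H : ∀ n, n ≠ 0 → h n = ∑ p ∈ n.divisorsAntidiagonal, f p.1 * g p.2) :
    LSeries h s = LSeries f s * LSeries g s := by
  rw [← LSeries_convolution' hf hg, LSeries.convolution_def]
  exact LSeries_congr (fun {n} hn => H n hn) s

theorem LSeriesSummable_of_le {f g : ℕ → ℕ} {s : ℂ} (hg : LSeriesSummable (fun n => (g n : ℂ)) s)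
    (h : ∀ n, n ≠ 0 → f n ≤ g n) : LSeriesSummable (fun n => (f n : ℂ)) s := by
  refine Summable.of_norm_bounded hg.norm fun n => ?_
  rcases eq_or_ne n 0 with rfl | hn
  · simp
  · exact LSeries.norm_term_le s (by simpa using h n hn)

theorem LSeriesSummable_delta (s : ℂ) : LSeriesSummable LSeries.delta s := by
  refine summable_of_ne_finset_zero (s := {1}) fun n hn => ?_
  rw [LSeries.term_delta, if_neg (Finset.notMem_singleton.mp hn)]

theorem LSeriesSummable_natCast {s : ℂ} (hs : 2 < s.re) : LSeriesSummable (fun n => (n : ℂ)) s :=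
  LSeriesSummable_of_le_const_mul_rpow hs ⟨1, fun n _ => by norm_num⟩

theorem LSeries_natCast {s : ℂ} (hs : 2 < s.re) :
    LSeries (fun n => (n : ℂ)) s = riemannZeta (s - 1) := by
  rw [← LSeries_one_eq_riemannZeta (s := s - 1) (by simp; linarith)]
  refine tsum_congr fun n => ?_
  rcases eq_or_ne n 0 with rfl | hn
  · simp
  have hn' : (n : ℂ) ≠ 0 := Nat.cast_ne_zero.mpr hn
  rw [LSeries.term_of_ne_zero hn, LSeries.term_of_ne_zero hn, Complex.cpow_sub _ _ hn',
    Complex.cpow_one, Pi.one_apply, one_div_div]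

theorem sigma_one_eq_sum_divisorsAntidiagonal (n : ℕ) :
    ((σ 1 n : ℕ) : ℂ) = ∑ p ∈ n.divisorsAntidiagonal, (1 : ℕ → ℂ) p.1 * (p.2 : ℂ) := by
  rw [sigma_one_apply, ← Nat.sum_divisorsAntidiagonal' (fun _ d => d)]
  simp

theorem LSeriesSummable_sigma_one {s : ℂ} (hs : 2 < s.re) :
    LSeriesSummable (fun n => ((σ 1 n : ℕ) : ℂ)) s := by
  have h := LSeriesSummable.convolution
    (LSeriesSummable_one_iff.mpr (by linarith : 1 < s.re)) (LSeriesSummable_natCast hs)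
  rw [LSeries.convolution_def] at h
  exact (LSeriesSummable_congr s fun {n} _ => sigma_one_eq_sum_divisorsAntidiagonal n).mpr h

theorem LSeries_sigma_one {s : ℂ} (hs : 2 < s.re) :
    LSeries (fun n => ((σ 1 n : ℕ) : ℂ)) s = riemannZeta s * riemannZeta (s - 1) := by
  rw [← LSeries_natCast hs, ← LSeries_one_eq_riemannZeta (by linarith : 1 < s.re)]
  exact LSeries_eq_mul_of_sum_divisorsAntidiagonal
    (LSeriesSummable_one_iff.mpr (by linarith)) (LSeriesSummable_natCast hs)
    fun n _ => sigma_one_eq_sum_divisorsAntidiagonal n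

theorem summable_norm_primes_cpow {s : ℂ} (hs : 1 < s.re) :
    Summable fun p : Nat.Primes => ‖-((p : ℕ) : ℂ) ^ (-s)‖ := by
  refine (Nat.Primes.summable_rpow.mpr (neg_lt_neg hs)).congr fun p => ?_
  rw [norm_neg, Complex.norm_natCast_cpow_of_pos p.2.pos, Complex.neg_re]

variable {F : Type*} [Field F]

theorem multipliable_splitPrimes {s : ℂ} (hs : 1 < s.re) :
    Multipliable fun p : splitPrimes F => 1 - ((p : ℕ) : ℂ) ^ (-s) := by
  simp only [sub_eq_add_neg]
  refine multipliable_one_add_of_summable ?_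
  exact (summable_norm_primes_cpow hs).comp_injective
    (i := fun p : splitPrimes F => (⟨p, p.2.1⟩ : Nat.Primes))
    fun p q h => Subtype.ext (congrArg (fun r : Nat.Primes => (r : ℕ)) h)

theorem LSeriesSummable_splitIndicator {s : ℂ} (hs : 1 < s.re) :
    LSeriesSummable (fun n => (splitIndicator F n : ℂ)) s := by
  refine LSeriesSummable_of_le (g := fun _ => 1) (s := s) ?_ fun n _ => ?_
  · exact (LSeriesSummable_congr s fun {n} _ => by simp).mpr (LSeriesSummable_one_iff.mpr hs)
  · rw [splitIndicator_apply]
    split_ifs <;> simp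

/-- The summand of the `L`-series of the indicator function of products of split primes, as a
monoid homomorphism. -/
noncomputable def splitSummandHom (F : Type*) [Field F] {s : ℂ} (hs : s ≠ 0) :
    ℕ →*₀ ℂ where
  toFun n := splitIndicator F n * riemannZetaSummandHom hs n
  map_zero' := by simp
  map_one' := by simp [splitIndicator_one]
  map_mul' m n := by rw [splitIndicator_mul, map_mul]; push_cast; ring

/-- `splitIndicator` is completely multiplicative, so its Euler factors are the inverses of `1 -
p^{-s}` at split primes and `1` elsewhere. -/
theorem tprod_splitPrimes_mul_LSeries {s : ℂ} (hs : 1 < s.re) :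
    (∏' p : splitPrimes F, (1 - ((p : ℕ) : ℂ) ^ (-s))) *
      LSeries (fun n => (splitIndicator F n : ℂ)) s = 1 := by
  classical
  have hs0 : s ≠ 0 := Complex.ne_zero_of_one_lt_re hs
  have hterm : ∀ n, splitSummandHom F hs0 n =
      LSeries.term (fun n => (splitIndicator F n : ℂ)) s n := by
    intro n
    rcases eq_or_ne n 0 with rfl | hn
    · simp
    · rw [LSeries.term_of_ne_zero hn, div_eq_mul_inv, ← Complex.cpow_neg]
      rfl
  have hsum : Summable fun n => ‖splitSummandHom F hs0 n‖ := by
    simp only [hterm]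
    exact (LSeriesSummable_splitIndicator hs).norm
  have heuler := EulerProduct.eulerProduct_completely_multiplicative_hasProd hsum
  have hval : ∀ p : Nat.Primes, splitSummandHom F hs0 p =
      if (p : ℕ) ∈ splitPrimes F then ((p : ℕ) : ℂ) ^ (-s) else 0 := by
    intro p
    have h := splitIndicator_prime_pow (F := F) p.2 one_ne_zero
    rw [pow_one] at h
    change (splitIndicator F p : ℂ) * ((p : ℕ) : ℂ) ^ (-s) = _
    rw [h]
    split_ifs <;> simp
  have hne : ∀ p : Nat.Primes, 1 - splitSummandHom F hs0 p ≠ 0 := by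
    intro p h
    have hlt : ‖splitSummandHom F hs0 p‖ < 1 := by
      rw [hval]
      split_ifs
      · rw [Complex.norm_natCast_cpow_of_pos p.2.pos, Complex.neg_re]
        exact Real.rpow_lt_one_of_one_lt_of_neg (by exact_mod_cast p.2.one_lt) (by linarith)
      · simp
    rw [← sub_eq_zero.mp h, norm_one] at hlt
    exact lt_irrefl _ hlt
  have hmult : Multipliable fun p : Nat.Primes => 1 - splitSummandHom F hs0 p := by
    simp only [sub_eq_add_neg]
    refine multipliable_one_add_of_summable ?_
    refine Summable.of_nonneg_of_le (fun _ => norm_nonneg _) (fun p => ?_)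
      (summable_norm_primes_cpow hs)
    rw [hval]
    split_ifs
    · exact le_rfl
    · simp
  have hprod : ∏' p : splitPrimes F, (1 - ((p : ℕ) : ℂ) ^ (-s)) =
      ∏' p : Nat.Primes, (1 - splitSummandHom F hs0 p) := by
    rw [tprod_subtype (splitPrimes F) fun n => 1 - (n : ℂ) ^ (-s)]
    simp only [hval]
    refine Eq.trans ?_ (tprod_subtype {p : ℕ | p.Prime}
      fun n => 1 - if n ∈ splitPrimes F then (n : ℂ) ^ (-s) else 0).symm
    refine tprod_congr fun n => ?_
    simp only [Set.mulIndicator_apply]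
    by_cases h : n ∈ splitPrimes F
    · rw [if_pos h, if_pos (show n ∈ {p : ℕ | p.Prime} from h.1), if_pos h]
    · simp [h]
  rw [hprod, LSeries, ← tsum_congr hterm, ← heuler.tprod_eq, ← hmult.tprod_mul heuler.multipliable]
  simp [mul_inv_cancel₀ (hne _)]

variable [NumberField F]

theorem classCountOfNorm_le_idealCount {n : ℕ} (hn : n ≠ 0) : classCountOfNorm F n ≤
    Nat.card {I : Ideal (𝓞 F) // Ideal.absNorm I = n} := by
  have hne : ∀ I : {I : Ideal (𝓞 F) // Ideal.absNorm I = n}, I.1 ∈ (Ideal (𝓞 F))⁰ := fun I =>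
    Ideal.absNorm_ne_zero_iff_mem_nonZeroDivisors.mp (I.2.trans_ne hn)
  refine Nat.card_le_card_of_surjective (β := classesOfNorm F n)
    (fun I => ⟨ClassGroup.mk0 ⟨I.1, hne I⟩, ⟨I.1, hne I⟩, I.2, rfl⟩) ?_
  rintro ⟨_, J, hJ, rfl⟩
  exact ⟨⟨J, hJ⟩, rfl⟩

theorem generatingCount_one : generatingCount F 1 = 1 := by
  rw [generatingCount, Nat.card_eq_one_iff_unique]
  have key : ∀ K : generatingSublattices (⊤ : Ideal (𝓞 F)) 1, (K : AddSubgroup (𝓞 F)) = ⊤ :=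
    fun K => AddSubgroup.index_eq_one.mp ((AddSubgroup.relIndex_top_right _).symm.trans K.2.2)
  exact ⟨⟨fun K K' => Subtype.ext ((key K).trans (key K').symm)⟩,
    ⟨⟨⊤, Ideal.span_eq ⊤, AddSubgroup.relIndex_self _⟩⟩⟩

theorem exists_unit_of_card_ne_two [Finite (𝓞 F)ˣ] (h : Nat.card (𝓞 F)ˣ ≠ 2) :
    ∃ u : (𝓞 F)ˣ, u ≠ 1 ∧ u ≠ -1 := by
  classical
  have := Fintype.ofFinite (𝓞 F)ˣ
  by_contra! hu
  refine h (le_antisymm ?_ two_le_card_units)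
  rw [Nat.card_eq_fintype_card, ← Finset.card_univ]
  refine (Finset.card_le_card fun u _ => ?_).trans (Finset.card_le_two (a := 1) (b := -1))
  rw [Finset.mem_insert, Finset.mem_singleton]
  exact or_iff_not_imp_left.mpr (hu u)

variable [Algebra.IsQuadraticExtension ℚ F]

/-- This is a single term of the convolution identity for `σ 1 n`, and it yields convergence for `Re
s > 2`. -/
theorem idealCount_le_sigma {n : ℕ} (hn : n ≠ 0) :
    Nat.card {I : Ideal (𝓞 F) // Ideal.absNorm I = n} ≤ σ 1 n := by
  rw [← sum_idealCount_mul_generatingCount (F := F) hn]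
  refine le_trans ?_ (Finset.single_le_sum (fun _ _ => Nat.zero_le _)
    (show (n, 1) ∈ n.divisorsAntidiagonal by simp [hn]))
  rw [generatingCount_one, mul_one]

theorem generatingCount_le_sigma {n : ℕ} (hn : n ≠ 0) : generatingCount F n ≤ σ 1 n := by
  rw [← sum_idealCount_mul_generatingCount (F := F) hn]
  refine le_trans ?_ (Finset.single_le_sum (fun _ _ => Nat.zero_le _)
    (show (1, n) ∈ n.divisorsAntidiagonal by simp [hn]))
  rw [← idealCount_apply one_ne_zero, idealCount_one, one_mul]

theorem card_quotient_scalingSetoid_le_sigma {J : Ideal (𝓞 F)} (hJ : J ≠ ⊥) {m : ℕ} (hm : m ≠ 0) :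
    Nat.card (Quotient (scalingSetoid J m)) ≤ σ 1 m := by
  have := finite_sublatticesOfIdeal hJ hm
  rw [← card_sublatticesOfIdeal hJ hm]
  exact Nat.card_le_card_of_surjective _ Quotient.mk_surjective

end Series

end BinaryLattice

/-! ### Assembly of the formula. -/

open BinaryLattice

theorem theorem1p1
    {V : Type*} [AddCommGroup V] [Module ℚ V]
    -- a positive definite binary quadratic space and a `ℤ`-lattice `L = ℤ e₀ + ℤ e₁` on it
    (Q : QuadraticForm ℚ V) (hQ : ∀ v : V, v ≠ 0 → 0 < Q v)
    (e : Module.Basis (Fin 2) ℚ V)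
    (L : Submodule ℤ V) (hL : L = Submodule.span ℤ (Set.range e))
    (hint : ∀ x ∈ L, ∃ k : ℤ, Q x = k)
    -- an imaginary quadratic field of discriminant `-4 d_L`
    {F : Type*} [Field F] [NumberField F] [Algebra.IsQuadraticExtension ℚ F]
    [NumberField.IsTotallyComplex F]
    (hdisc : (NumberField.discr F : ℚ) = -4 * (BinaryLattice.gramMatrix Q e).det)
    (s : ℂ) (hs : 2 < s.re) :
    -- the series and the product in the formula converge, and the denominator does not vanish
    LSeriesSummable (fun m => (BinaryLattice.properClassCount Q L m : ℂ)) s ∧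
    LSeriesSummable (fun n => (BinaryLattice.classCountOfNorm F n : ℂ)) s ∧
    LSeriesSummable
      (fun n => (Nat.card {I : Ideal (NumberField.RingOfIntegers F) // Ideal.absNorm I = n} : ℂ))
      s ∧
    Multipliable (fun p : BinaryLattice.splitPrimes F => 1 - ((p : ℕ) : ℂ) ^ (-s)) ∧
    NumberField.dedekindZeta F s ≠ 0 ∧
    LSeries (fun m => (BinaryLattice.properClassCount Q L m : ℂ)) s =
      2 / (Nat.card (NumberField.RingOfIntegers F)ˣ : ℂ) *
          (riemannZeta s * riemannZeta (s - 1) / NumberField.dedekindZeta F s) *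
          LSeries (fun n => (BinaryLattice.classCountOfNorm F n : ℂ)) s +
        ((Nat.card (NumberField.RingOfIntegers F)ˣ : ℂ) - 2) /
            (Nat.card (NumberField.RingOfIntegers F)ˣ : ℂ) *
          (∏' p : BinaryLattice.splitPrimes F, (1 - ((p : ℕ) : ℂ) ^ (-s))) *
          NumberField.dedekindZeta F s := by
  have hneg : NumberField.discr F < 0 := by
    have : (NumberField.discr F : ℚ) < 0 := by
      rw [hdisc]
      linarith [det_gramMatrix_pos Q hQ e]
    exact_mod_cast this
  have := finite_units hneg
  have hs1 : 1 < s.re := by linarith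
  obtain ⟨φ, I, b, β, γ, hN, h0, h1, hI, hLI⟩ :=
    exists_quadratic_identification (F := F) Q hQ e L hL hint hdisc
  have hcount : ∀ {m : ℕ}, m ≠ 0 →
      properClassCount Q L m = Nat.card (Quotient (scalingSetoid I m)) := fun hm =>
    properClassCount_eq hQ φ (hQ _ (e.ne_zero 0)) hN b h0 h1 hI hLI hm
  have hσ := LSeriesSummable_sigma_one hs
  have hi := LSeriesSummable_of_le hσ fun n hn => idealCount_le_sigma (F := F) hn
  have hh := LSeriesSummable_of_le hi fun n hn => classCountOfNorm_le_idealCount (F := F) hn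
  have hb := LSeriesSummable_of_le hσ fun n hn => generatingCount_le_sigma (F := F) hn
  have ha : LSeriesSummable (fun m => (properClassCount Q L m : ℂ)) s :=
    LSeriesSummable_of_le hσ fun m hm =>
      (hcount hm).trans_le (card_quotient_scalingSetoid_le_sigma hI hm)
  have hζ : riemannZeta s * riemannZeta (s - 1) = NumberField.dedekindZeta F s *
      LSeries (fun n => (generatingCount F n : ℂ)) s := by
    rw [← LSeries_sigma_one hs, NumberField.dedekindZeta]
    refine LSeries_eq_mul_of_sum_divisorsAntidiagonal hi hb fun n hn => ?_
    rw [← sum_idealCount_mul_generatingCount (F := F) hn]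
    push_cast
    rfl
  -- `ζ_F(s)` is a factor of `ζ(s)ζ(s-1)`, which does not vanish since both arguments have real part
  -- above one.
  have hζ0 : NumberField.dedekindZeta F s ≠ 0 := by
    refine left_ne_zero_of_mul (hζ.symm.trans_ne (mul_ne_zero
      (riemannZeta_ne_zero_of_one_le_re hs1.le) (riemannZeta_ne_zero_of_one_le_re ?_)))
    rw [Complex.sub_re, Complex.one_re]
    linarith
  refine ⟨ha, hh, hi, multipliable_splitPrimes hs1, hζ0, ?_⟩
  set w := Nat.card (NumberField.RingOfIntegers F)ˣ with hw
  have hw2 : 2 ≤ w := two_le_card_units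
  have hw0 : (w : ℂ) ≠ 0 := by
    have : w ≠ 0 := by omega
    exact_mod_cast this
  have hwa : (w : ℂ) * LSeries (fun m => (properClassCount Q L m : ℂ)) s =
      LSeries (fun n => (classCountOfNorm F n : ℂ)) s *
        (2 * LSeries (fun n => (generatingCount F n : ℂ)) s + (w - 2)) := by
    have hδ := LSeriesSummable_delta s
    have hsum : LSeries ((2 : ℂ) • (fun n => (generatingCount F n : ℂ)) +
        ((w : ℂ) - 2) • LSeries.delta) s =
        2 * LSeries (fun n => (generatingCount F n : ℂ)) s + (w - 2) := by
      rw [LSeries_add (hb.smul _) (hδ.smul _), LSeries_smul, LSeries_smul, LSeries_delta,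
        Pi.one_apply, mul_one]
    rw [← hsum, ← LSeries_smul]
    refine LSeries_eq_mul_of_sum_divisorsAntidiagonal hh ((hb.smul _).add (hδ.smul _))
      fun n hn => ?_
    have := card_units_mul_card_quotient_scalingSetoid
      (fun u hu hu' => adjoin_unit_eq_top hneg hu hu') hI hn
    rw [← hcount hn, ← hw] at this
    have := congrArg (Nat.cast : ℕ → ℂ) this
    push_cast [Nat.cast_sub hw2] at this
    simpa [LSeries.delta] using this
  -- The factor `w - 2` is kept because without it the equality is only derived when units beyond
  -- `±1` exist, where the class number is one.
  have hsplit : ((w : ℂ) - 2) * LSeries (fun n => (classCountOfNorm F n : ℂ)) s =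
      ((w : ℂ) - 2) * ((∏' p : BinaryLattice.splitPrimes F, (1 - ((p : ℕ) : ℂ) ^ (-s))) *
          NumberField.dedekindZeta F s) := by
    rcases eq_or_ne w 2 with h2 | h2
    · simp [h2]
    congr 1
    obtain ⟨u, hu, hu'⟩ := exists_unit_of_card_ne_two h2
    have := isPrincipalIdealRing_of_unit hneg hu hu'
    have hi' : NumberField.dedekindZeta F s = LSeries (fun n => (classCountOfNorm F n : ℂ)) s *
        LSeries (fun n => (splitIndicator F n : ℂ)) s := by
      refine LSeries_eq_mul_of_sum_divisorsAntidiagonal hh (LSeriesSummable_splitIndicator hs1)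
        fun n hn => ?_
      rw [← idealCount_apply hn, idealCount_eq_normIndicator_mul_splitIndicator,
        ArithmeticFunction.mul_apply]
      push_cast
      refine Finset.sum_congr rfl fun p hp => ?_
      rw [classCountOfNorm_eq_normIndicator
        (Nat.pos_of_mem_divisors (Nat.fst_mem_divisors_of_mem_antidiagonal hp)).ne']
    rw [hi', mul_left_comm, tprod_splitPrimes_mul_LSeries hs1, mul_one]
  rw [hζ, mul_div_cancel_left₀ _ hζ0]
  refine mul_left_cancel₀ hw0 ?_
  rw [hwa]
  field_simp
  linear_combination hsplit
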